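/- **Setting.** Let $\mathcal H$ be a (fixed, infinite-dimensional) separable complex Hilbert space, with inner product linear in the first slot, and $(u\otimes v)w=u\langle w,v\rangle$. For a densely defined closed operator $A$ on $\mathcal H$ let $\operatorname{Spec}(A)$ be its spectrum and let $\rho_F^{(0)}(A)$ be the set of $z\in\mathbb C$ for which $A-z$ is a Fredholm operator of index $0$ (closed range, finite-dimensional kernel and cokernel of equal dimension). An operator $T$ has discrete spectrum if every point of $\operatorname{Spec}(T)$ is isolated in $\operatorname{Spec}(T)$ and is an eigenvalue of finite multiplicity. The products $(A-z)^*(A-z)$ and $(A-z)(A-z)^*$ are taken on their natural domains. For $\alpha>0$ and $z\in\mathbb C$ let $\mathcal H_{1,\alpha}(A,z)$ and $\mathcal H_{2,\alpha}(A,z)$ be the linear spans of the eigenvectors, with eigenvalue less than $\alpha$, of $(A-z)(A-z)^*$ and of $(A-z)^*(A-z)$ respectively. The operator, Hilbert–Schmidt and trace norms are written $\|\cdot\|$, $\|\cdot\|_{\mathrm{HS}}$, $\|\cdot\|_{\mathrm{Tr}}$. **Theorem.** Suppose that: 1. $A=A(h)$, $h>0$, is a family of closed, densely defined, possibly unbounded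 operators on $\mathcal H$. 2. For every $h>0$, $(D_j)_{j\in\mathcal J}$, with $\mathcal J$ at most countable, is a family of pairwise disjoint, open, connected subsets of $\mathbb C$ (which may depend on $h$) with $\bigcup_j D_j\subset\rho_F^{(0)}(A)$, and $z_j\in D_j$ are points such that $(A-z_j)^*(A-z_j)$ has discrete spectrum for all $j\in\mathcal J$. 3. For all $h,\alpha>0$, $S_1=S_1(h,\alpha)$ and $S_2=S_2(h,\alpha)$ are Hilbert–Schmidt operators on $\mathcal H$ and $C_S=C_S(h,\alpha)>0$ is a constant such that, for all $j\in\mathcal J$, $$\|S_1^*v\|\ge C_S\|v\|\quad\forall v\in\mathcal H_{1,\alpha}(A,z_j),\qquad \|S_2w\|\ge C_S\|w\|\quad\forall w\in\mathcal H_{2,\alpha}(A,z_j).$$ 4. $S_1(h,\alpha)$ is trace class for all $h,\alpha>0$. Let $(e^1_j)_{j\in\mathbb N}$ and $(e^2_j)_{j\in\mathbb N}$ be orthonormal bases of $\mathcal H$ and let $\alpha_{j,k}$ be independent standard complex Gaussian random variables (density $\pi^{-1}e^{-|\zeta|^2}$ on $\mathbb C$). Then for all $h,\alpha>0$ the limit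 in operator norm $$Q_\omega=S_1\circ\Big(\sum_{j,k}\alpha_{j,k}\,e^1_j\otimes e^2_k\Big)\circ S_2:=\lim_{n\to\infty}S_1\circ\Big(\sum_{j,k\le n}\alpha_{j,k}\,e^1_j\otimes e^2_k\Big)\circ S_2$$ exists almost surely, and there is a constant $C_0>0$, independent of $h$, $\alpha$ and $\delta$, such that for all $h,\alpha,\delta>0$ the set $\operatorname{Spec}(A+\delta Q_\omega)\cap\bigcup_{j\in\mathcal J}D_j$ is discrete with probability at least $$\max\left(1-C_0\exp\left(\frac{C_0\|S_1\|\,\|S_1\|_{\mathrm{Tr}}\,\|S_2\|_{\mathrm{HS}}^2-\alpha\delta^{-2}}{2\|S_1\|^{3/2}\|S_2\|}\right),\,0\right)$$ (on a measurable event of at least this probability; the quotient is read as $0$ if its denominator vanishes). -/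

import Mathlib

open MeasureTheory ProbabilityTheory Filter Topology

noncomputable section

namespace RandomPerturbation

/-! ### Unbounded operators on a Hilbert space -/

section Operators

variable {H : Type*} [NormedAddCommGroup H] [InnerProductSpace ℂ H]

/-- `T + B` for an unbounded operator `T` and a bounded everywhere defined operator `B`;
the domain is the domain of `T`. -/
def addBounded (T : H →ₗ.[ℂ] H) (B : H →L[ℂ] H) : H →ₗ.[ℂ] H :=
  (B : H →ₗ[ℂ] H) +ᵥ T

/-- `T - z`, with the domain of `T`. -/
def shift (T : H →ₗ.[ℂ] H) (z : ℂ) : H →ₗ.[ℂ] H :=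
  addBounded T (-(z • ContinuousLinearMap.id ℂ H))

/-- The product `S T` of two unbounded operators on its natural domain
`{x ∈ D(T) : T x ∈ D(S)}`. -/
def mul (S T : H →ₗ.[ℂ] H) : H →ₗ.[ℂ] H where
  domain :=
    { carrier := {x | ∃ hx : x ∈ T.domain, T ⟨x, hx⟩ ∈ S.domain}
      zero_mem' := ⟨T.domain.zero_mem, by
        have h : T ⟨0, T.domain.zero_mem⟩ = 0 := T.map_zero
        rw [h]
        exact S.domain.zero_mem⟩
      add_mem' := by
        rintro x y ⟨hx, hx'⟩ ⟨hy, hy'⟩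
        refine ⟨T.domain.add_mem hx hy, ?_⟩
        have h : T ⟨x + y, T.domain.add_mem hx hy⟩ = T ⟨x, hx⟩ + T ⟨y, hy⟩ :=
          T.map_add ⟨x, hx⟩ ⟨y, hy⟩
        rw [h]
        exact S.domain.add_mem hx' hy'
      smul_mem' := by
        rintro c x ⟨hx, hx'⟩
        refine ⟨T.domain.smul_mem c hx, ?_⟩
        have h : T ⟨c • x, T.domain.smul_mem c hx⟩ = c • T ⟨x, hx⟩ :=
          T.map_smul c ⟨x, hx⟩
        rw [h]
        exact S.domain.smul_mem c hx' }
  toFun :=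
    { toFun := fun x => S ⟨T ⟨x.1, x.2.choose⟩, x.2.choose_spec⟩
      map_add' := by
        intro x y
        rw [← S.map_add]
        congr 1
        apply Subtype.ext
        exact T.map_add ⟨x.1, x.2.choose⟩ ⟨y.1, y.2.choose⟩
      map_smul' := by
        intro c x
        rw [RingHom.id_apply, ← S.map_smul]
        congr 1
        apply Subtype.ext
        exact T.map_smul c ⟨x.1, x.2.choose⟩ }

/-- `Spec T`: the set of `z` for which `T - z : D(T) → H` does not have a bounded everywhere
defined two-sided inverse. -/
def spec (T : H →ₗ.[ℂ] H) : Set ℂ :=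
  {z | ¬ ∃ R : H →L[ℂ] H,
      (∀ y : H, ∃ hy : R y ∈ (shift T z).domain, shift T z ⟨R y, hy⟩ = y) ∧
      ∀ x : (shift T z).domain, R (shift T z x) = x}

/-- `T` is a densely defined closed operator with closed range, finite-dimensional kernel and
finite-dimensional cokernel. -/
structure IsFredholm (T : H →ₗ.[ℂ] H) : Prop where
  closed : T.IsClosed
  dense : Dense (T.domain : Set H)
  closed_range : IsClosed (LinearMap.range T.toFun : Set H)
  finite_ker : FiniteDimensional ℂ (LinearMap.ker T.toFun)
  finite_coker : FiniteDimensional ℂ (H ⧸ LinearMap.range T.toFun)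

/-- The index `dim ker T - dim coker T` (used for Fredholm operators only). -/
def fredholmIndex (T : H →ₗ.[ℂ] H) : ℤ :=
  (Module.finrank ℂ (LinearMap.ker T.toFun) : ℤ) -
    (Module.finrank ℂ (H ⧸ LinearMap.range T.toFun) : ℤ)

/-- The index-`0` Fredholm domain of `A`. -/
def fredholmDomainZero (A : H →ₗ.[ℂ] H) : Set ℂ :=
  {z | IsFredholm (shift A z) ∧ fredholmIndex (shift A z) = 0}

/-- `T` has discrete spectrum: every point of `Spec T` is a normal eigenvalue, that is, an
isolated point of the spectrum and an eigenvalue of finite multiplicity. -/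
def HasDiscreteSpectrum (T : H →ₗ.[ℂ] H) : Prop :=
  ∀ z ∈ spec T,
    (∃ ε > 0, spec T ∩ Metric.ball z ε = {z}) ∧
    LinearMap.ker (shift T z).toFun ≠ ⊥ ∧
    FiniteDimensional ℂ (LinearMap.ker (shift T z).toFun)

/-- The span of all eigenvectors of `T` with a (real) eigenvalue less than `α`. -/
def lowSpace (T : H →ₗ.[ℂ] H) (α : ℝ) : Submodule ℂ H :=
  Submodule.span ℂ
    {u | ∃ lam : ℝ, lam < α ∧ ∃ hu : u ∈ T.domain, T ⟨u, hu⟩ = (lam : ℂ) • u}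

variable [CompleteSpace H]

/-- `(A - z)^* (A - z)` on its natural domain. -/
def rightSquare (A : H →ₗ.[ℂ] H) (z : ℂ) : H →ₗ.[ℂ] H :=
  mul (shift A z).adjoint (shift A z)

/-- `(A - z) (A - z)^*` on its natural domain. -/
def leftSquare (A : H →ₗ.[ℂ] H) (z : ℂ) : H →ₗ.[ℂ] H :=
  mul (shift A z) (shift A z).adjoint

/-! ### Hilbert–Schmidt and trace class operators -/

/-- An index set for some orthonormal basis of `H`. -/
def onbIndex (H : Type*) [NormedAddCommGroup H] [InnerProductSpace ℂ H] [CompleteSpace H] :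
    Set H :=
  (exists_hilbertBasis ℂ H).choose

/-- Some orthonormal basis of `H`. The notions below do not depend on which one is used. -/
def onb (H : Type*) [NormedAddCommGroup H] [InnerProductSpace ℂ H] [CompleteSpace H] :
    HilbertBasis (onbIndex H) ℂ H :=
  (exists_hilbertBasis ℂ H).choose_spec.choose

def IsHilbertSchmidt (S : H →L[ℂ] H) : Prop :=
  Summable fun i => ‖S (onb H i)‖ ^ 2

/-- The Hilbert–Schmidt norm (of a Hilbert–Schmidt operator). -/
def hsNorm (S : H →L[ℂ] H) : ℝ :=
  Real.sqrt (∑' i, ‖S (onb H i)‖ ^ 2)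

/-- `S` is trace class: `|S| = (S^* S)^{1/2}` has finite trace. -/
def IsTraceClass (S : H →L[ℂ] H) : Prop :=
  Summable fun i => (inner ℂ (onb H i) (CFC.abs S (onb H i))).re

/-- The trace norm `tr |S|` (of a trace class operator). -/
def traceNorm (S : H →L[ℂ] H) : ℝ :=
  ∑' i, (inner ℂ (onb H i) (CFC.abs S (onb H i))).re

/-! ### The random perturbation -/

/-- `S₁ ∘ (∑_{j,k<n} a_{jk} e¹_j ⊗ e²_k) ∘ S₂`, where `(u ⊗ v) w = ⟨w, v⟩ u` (the inner product
being linear in `w`). -/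
def truncation (e₁ e₂ : HilbertBasis ℕ ℂ H) (S₁ S₂ : H →L[ℂ] H) (a : ℕ → ℕ → ℂ) (n : ℕ) :
    H →L[ℂ] H :=
  S₁ ∘L (∑ j ∈ Finset.range n, ∑ k ∈ Finset.range n,
    a j k • InnerProductSpace.rankOne ℂ (e₁ j) (e₂ k)) ∘L S₂

/-- `S₁ ∘ (∑_{j,k} a_{jk} e¹_j ⊗ e²_k) ∘ S₂`: the limit in operator norm of the square
truncations. -/
def perturbation (e₁ e₂ : HilbertBasis ℕ ℂ H) (S₁ S₂ : H →L[ℂ] H) (a : ℕ → ℕ → ℂ) :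
    H →L[ℂ] H :=
  limUnder atTop (truncation e₁ e₂ S₁ S₂ a)

end Operators

/-- The standard complex Gaussian law `π⁻¹ exp(-|z|²) dm(z)` (mean `0`, variance `E|z|² = 1`). -/
def stdComplexGaussian : Measure ℂ :=
  (volume : Measure ℂ).withDensity fun z => ENNReal.ofReal (Real.exp (-‖z‖ ^ 2) / Real.pi)

end RandomPerturbation

end

open RandomPerturbation

/-! The spectrum of $A+\delta Q_\omega$ in $\bigcup_j D_j$ is discrete almost surely, so the
probability bound holds with $C_0=1$, its left side being at most $1$.

Fix $j$. The point $z_j$ is an index-zero Fredholm point, and both $\ker(A-z_j)$ and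
$\operatorname{ran}(A-z_j)^\perp$ consist of eigenvectors for the eigenvalue $0<\alpha$ (and the
zero vector). The lower bounds therefore make $S_2$ injective on the kernel and $S_1^*$ injective on
the complement of the range, and for some choice of finitely many coefficients the truncated
perturbation makes $A-z_j$ invertible (`exists_truncation_hasInverse`).

One good choice implies that almost every choice is good. With a finite-rank $\Phi$ and the inverse
$G$ of $A-z_j+\Phi$, invertibility of $A-z_j+K$ means that $1+(K-\Phi)G$ is a unit. Along a complex
line in a finite-rank direction through a unit, only finitely many points are non-units, so finite
Gaussian sums are almost surely good (`measure_pi_setOf_not_isUnit`). For the infinite series,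
condition on the coefficients outside a large square: when their contribution is small, openness of
the units keeps the good choice good, and the fibrewise bad set is null
(`ae_mem_of_tendsto_sum_smul`). Hence $z_j\notin\operatorname{Spec}(A+\delta Q_\omega)$ almost
surely, for all of the countably many $j$ at once.

Since $Q_\omega$ is a norm limit of finite-rank operators, the analytic Fredholm alternative on the
connected set $D_j$ shows that the spectrum either contains $D_j$ or has no accumulation point in it
(`eventually_notMem_spec`); $z_j$ excludes the former. Convergence of the series is proved in
Hilbert–Schmidt norm by Kolmogorov's maximal inequality. -/

noncomputable section

namespace RandomPerturbation

/-! ### Inverses of unbounded operators under bounded perturbation -/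

section BoundedInverse

variable {H : Type*} [NormedAddCommGroup H] [InnerProductSpace ℂ H]

/-- `R` is a bounded everywhere defined two-sided inverse of the unbounded operator `T`. -/
def HasInverse (T : H →ₗ.[ℂ] H) (R : H →L[ℂ] H) : Prop :=
  (∀ y : H, ∃ hy : R y ∈ T.domain, T ⟨R y, hy⟩ = y) ∧ ∀ x : T.domain, R (T x) = x

theorem notMem_spec_iff {T : H →ₗ.[ℂ] H} {z : ℂ} :
    z ∉ spec T ↔ ∃ R, HasInverse (shift T z) R := by
  simp [spec, HasInverse]

theorem addBounded_addBounded (T : H →ₗ.[ℂ] H) (K L : H →L[ℂ] H) :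
    addBounded (addBounded T K) L = addBounded T (K + L) := by
  unfold addBounded
  rw [vadd_vadd, add_comm]
  rfl

theorem addBounded_apply (T : H →ₗ.[ℂ] H) (K : H →L[ℂ] H) {x : H} (hx : x ∈ T.domain)
    (hx' : x ∈ (addBounded T K).domain) :
    addBounded T K ⟨x, hx'⟩ = K x + T ⟨x, hx⟩ := rfl

/-- If `G` inverts `T`, then `T + K` is invertible as soon as `1 + K G` is. -/
theorem HasInverse.addBounded_of_isUnit {T : H →ₗ.[ℂ] H} {G K : H →L[ℂ] H} (hG : HasInverse T G)
    (h : IsUnit (1 + K * G)) : ∃ R, HasInverse (addBounded T K) R := by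
  obtain ⟨u, hu⟩ := h
  have h1 : (1 + K * G) * (↑u⁻¹ : H →L[ℂ] H) = 1 := by rw [← hu]; exact u.mul_inv
  have h2 : (↑u⁻¹ : H →L[ℂ] H) * (1 + K * G) = 1 := by rw [← hu]; exact u.inv_mul
  refine ⟨G * ↑u⁻¹, fun y => ?_, fun x => ?_⟩
  · obtain ⟨hy, hy'⟩ := hG.1 ((↑u⁻¹ : H →L[ℂ] H) y)
    refine ⟨hy, ?_⟩
    have h3 : (↑u⁻¹ : H →L[ℂ] H) y + K (G ((↑u⁻¹ : H →L[ℂ] H) y)) = y := DFunLike.congr_fun h1 y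
    refine (addBounded_apply T K hy hy).trans ?_
    rw [hy', add_comm]
    exact h3
  · obtain ⟨x, hx⟩ := x
    have hx0 : x ∈ T.domain := hx
    have h3 : (↑u⁻¹ : H →L[ℂ] H) (T ⟨x, hx0⟩ + K (G (T ⟨x, hx0⟩))) = T ⟨x, hx0⟩ :=
      DFunLike.congr_fun h2 (T ⟨x, hx0⟩)
    have h4 : G (T ⟨x, hx0⟩) = x := hG.2 ⟨x, hx0⟩
    rw [h4, add_comm] at h3
    change G ((↑u⁻¹ : H →L[ℂ] H) (addBounded T K ⟨x, hx⟩)) = x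
    rw [addBounded_apply T K hx0 hx, h3, h4]

/-- If `G` inverts `T` and `T + K` is invertible, then so is `1 + K G`. -/
theorem HasInverse.isUnit {T : H →ₗ.[ℂ] H} {G K R : H →L[ℂ] H} (hG : HasInverse T G)
    (hR : HasInverse (addBounded T K) R) : IsUnit (1 + K * G) := by
  -- The resolvent identities $G=R+RKG=R+GKR$ make $1-KR$ a two-sided inverse of $1+KG$.
  have e1 : ∀ y, G y = R y + R (K (G y)) := fun y => by
    obtain ⟨hy, hy'⟩ := hG.1 y
    have hy0 : G y ∈ (addBounded T K).domain := hy
    have : R (addBounded T K ⟨G y, hy0⟩) = G y := hR.2 ⟨G y, hy0⟩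
    rw [addBounded_apply T K hy, hy', map_add] at this
    rw [add_comm, this]
  have e2 : ∀ y, R y + G (K (R y)) = G y := fun y => by
    obtain ⟨hy, hy'⟩ := hR.1 y
    have hy0 : R y ∈ T.domain := hy
    have : G (T ⟨R y, hy0⟩) = R y := hG.2 ⟨R y, hy0⟩
    rw [addBounded_apply T K hy0] at hy'
    rw [eq_sub_of_add_eq' hy', map_sub] at this
    exact (sub_eq_iff_eq_add.1 this).symm
  refine ⟨⟨1 + K * G, 1 - K * R, ?_, ?_⟩, rfl⟩
  · ext y
    have h1 := congrArg K (e2 y)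
    change y - K (R y) + K (G (y - K (R y))) = y
    simp only [map_add, map_sub] at h1 ⊢
    rw [← h1]; abel
  · ext y
    change y + K (G y) - K (R (y + K (G y))) = y
    have e3 : R (y + K (G y)) = G y := by rw [map_add]; exact (e1 y).symm
    rw [e3]; abel

theorem HasInverse.exists_iff {T : H →ₗ.[ℂ] H} {G : H →L[ℂ] H} (hG : HasInverse T G)
    (K : H →L[ℂ] H) : (∃ R, HasInverse (addBounded T K) R) ↔ IsUnit (1 + K * G) :=
  ⟨fun ⟨_, hR⟩ => hG.isUnit hR, hG.addBounded_of_isUnit⟩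

/-- A closed operator that is a bijection of its domain onto the space has a bounded inverse. -/
theorem exists_hasInverse_of_bijective [CompleteSpace H] {T : H →ₗ.[ℂ] H} (hT : T.IsClosed)
    (hinj : ∀ x : T.domain, T x = 0 → x = 0) (hsurj : ∀ y, ∃ x : T.domain, T x = y) :
    ∃ R, HasInverse T R := by
  have hker : LinearMap.ker T.toFun = ⊥ := LinearMap.ker_eq_bot'.2 hinj
  let e : T.domain ≃ₗ[ℂ] H := LinearEquiv.ofBijective T.toFun
    ⟨LinearMap.ker_eq_bot.1 hker, hsurj⟩
  let g : H →ₗ[ℂ] H := T.domain.subtype ∘ₗ e.symm.toLinearMap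
  have hg : ∀ y, ∃ hy : g y ∈ T.domain, T ⟨g y, hy⟩ = y := fun y =>
    ⟨(e.symm y).2, e.apply_symm_apply y⟩
  -- The graph of the inverse is the graph of `T` with its coordinates swapped, so the closed graph
  -- theorem applies.
  have hcl : IsClosed (g.graph : Set (H × H)) := by
    have : (g.graph : Set (H × H)) = Prod.swap ⁻¹' (T.graph : Set (H × H)) := by
      ext ⟨y, x⟩
      simp only [SetLike.mem_coe, LinearMap.mem_graph_iff, Set.mem_preimage, Prod.swap_prod_mk,
        LinearPMap.mem_graph_iff]
      constructor
      · rintro rfl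
        exact ⟨⟨g y, (hg y).1⟩, rfl, (hg y).2⟩
      · rintro ⟨w, rfl, h⟩
        have : e w = y := h
        rw [← this]
        simp [g]
    rw [this]
    exact hT.preimage continuous_swap
  refine ⟨⟨g, g.continuous_of_isClosed_graph hcl⟩, hg, fun x => ?_⟩
  have : e.symm (T x) = x := e.symm_apply_apply x
  exact congrArg Subtype.val this

theorem isClosed_addBounded {T : H →ₗ.[ℂ] H} (hT : T.IsClosed) (K : H →L[ℂ] H) :
    (addBounded T K).IsClosed := by
  have : ((addBounded T K).graph : Set (H × H)) =
      (fun p : H × H => (p.1, p.2 - K p.1)) ⁻¹' (T.graph : Set (H × H)) := by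
    ext ⟨x, y⟩
    simp only [SetLike.mem_coe, Set.mem_preimage, LinearPMap.mem_graph_iff]
    constructor
    · rintro ⟨⟨w, hw⟩, rfl, rfl⟩
      have hw0 : w ∈ T.domain := hw
      refine ⟨⟨w, hw0⟩, rfl, ?_⟩
      rw [addBounded_apply T K hw0]; simp
    · rintro ⟨⟨w, hw⟩, rfl, h⟩
      refine ⟨⟨w, hw⟩, rfl, ?_⟩
      refine (addBounded_apply T K hw hw).trans ?_
      rw [h]; simp
  unfold LinearPMap.IsClosed
  rw [this]
  exact IsClosed.preimage (by fun_prop) hT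

/-- Recentring at a Fredholm point `z`: once $T-z+\Phi$ has an inverse $G$, the whole dependence on
`K` and `w` sits in a bounded perturbation, and invertibility is read off from $1+(K-\Phi-(w-z))G$.
-/
theorem shift_addBounded (T : H →ₗ.[ℂ] H) (Φ K : H →L[ℂ] H) (z w : ℂ) :
    shift (addBounded T K) w =
      addBounded (addBounded (shift T z) Φ) (K - Φ - (w - z) • 1) := by
  unfold shift
  simp only [addBounded_addBounded]
  congr 1
  ext x
  simp only [add_apply, neg_apply,
    smul_apply, ContinuousLinearMap.id_apply, sub_apply,
    one_apply_eq_self, sub_smul]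
  abel

end BoundedInverse

/-! ### Index-zero Fredholm operators -/

section Fredholm

variable {H : Type*} [NormedAddCommGroup H] [InnerProductSpace ℂ H]

/-- The kernel of an unbounded operator as a subspace of the whole space. -/
def kernel (T : H →ₗ.[ℂ] H) : Submodule ℂ H := (LinearMap.ker T.toFun).map T.domain.subtype

theorem mem_kernel {T : H →ₗ.[ℂ] H} {x : H} :
    x ∈ kernel T ↔ ∃ hx : x ∈ T.domain, T ⟨x, hx⟩ = 0 := by
  simp [kernel]

theorem finiteDimensional_kernel {T : H →ₗ.[ℂ] H} (hT : IsFredholm T) :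
    FiniteDimensional ℂ (kernel T) := by
  have := hT.finite_ker
  unfold kernel
  infer_instance

variable [CompleteSpace H]

/-- The kernel of an index-zero Fredholm operator has the dimension of the orthogonal complement of
the range. -/
theorem exists_linearEquiv_kernel {T : H →ₗ.[ℂ] H} (hT : IsFredholm T)
    (hi : fredholmIndex T = 0) :
    FiniteDimensional ℂ ((LinearMap.range T.toFun)ᗮ : Submodule ℂ H) ∧
    Module.finrank ℂ (kernel T) = Module.finrank ℂ ((LinearMap.range T.toFun)ᗮ : Submodule ℂ H) := by
  have : CompleteSpace (LinearMap.range T.toFun) := hT.closed_range.completeSpace_coe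
  have e : (H ⧸ LinearMap.range T.toFun) ≃ₗ[ℂ] ((LinearMap.range T.toFun)ᗮ : Submodule ℂ H) :=
    Submodule.quotientEquivOfIsCompl _ _ (Submodule.isCompl_orthogonal _)
  have := hT.finite_coker
  have hfd := LinearEquiv.finiteDimensional e
  refine ⟨hfd, ?_⟩
  rw [← e.finrank_eq]
  have h1 : Module.finrank ℂ (kernel T) = Module.finrank ℂ (LinearMap.ker T.toFun) := by
    unfold kernel
    exact Submodule.finrank_map_subtype_eq _ _
  rw [h1]
  unfold fredholmIndex at hi
  omega

/-- An index-zero Fredholm operator becomes invertible after adding an operator that vanishes on the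
orthogonal complement of its kernel and maps the kernel onto the complement of the range. -/
theorem exists_hasInverse_addBounded {T : H →ₗ.[ℂ] H} (hT : IsFredholm T)
    (Φ : H →L[ℂ] H) (hΦ : ∀ x, Φ x ∈ (LinearMap.range T.toFun)ᗮ)
    (hinj : ∀ x ∈ kernel T, Φ x = 0 → x = 0)
    (hi : fredholmIndex T = 0) : ∃ G, HasInverse (addBounded T Φ) G := by
  obtain ⟨hfd, hrk⟩ := exists_linearEquiv_kernel hT hi
  have := finiteDimensional_kernel hT
  have : CompleteSpace (LinearMap.range T.toFun) := hT.closed_range.completeSpace_coe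
  have hrange : ∀ x : T.domain, T x ∈ LinearMap.range T.toFun := fun x => ⟨x, rfl⟩
  apply exists_hasInverse_of_bijective (isClosed_addBounded hT.closed Φ)
  · rintro ⟨x, hx⟩ h
    have hx0 : x ∈ T.domain := hx
    rw [addBounded_apply T Φ hx0] at h
    have h1 : Φ x = 0 := by
      have h2 : Φ x ∈ LinearMap.range T.toFun := by
        rw [eq_neg_of_add_eq_zero_left h]
        exact Submodule.neg_mem _ (hrange _)
      exact (Submodule.isOrtho_iff_inner_eq.1 (Submodule.isOrtho_orthogonal_right _) _ h2 _ (hΦ x))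
        |> inner_self_eq_zero.1
    have h2 : T ⟨x, hx0⟩ = 0 := by simpa [h1] using h
    exact Subtype.ext (hinj x (mem_kernel.2 ⟨hx0, h2⟩) h1)
  · intro y
    let φ : kernel T →ₗ[ℂ] ((LinearMap.range T.toFun)ᗮ : Submodule ℂ H) :=
      LinearMap.codRestrict _ (Φ.toLinearMap ∘ₗ (kernel T).subtype) (fun x => hΦ x)
    have hφ : Function.Injective φ := by
      rw [← LinearMap.ker_eq_bot, LinearMap.ker_eq_bot']
      intro x hx
      exact Subtype.ext (hinj x x.2 (congrArg Subtype.val hx))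
    have hφs : Function.Surjective φ :=
      (LinearMap.injective_iff_surjective_of_finrank_eq_finrank hrk).1 hφ
    -- Write $y=Tx+b$ with $b\perp\operatorname{ran}T$. Equality of dimensions makes `Φ` map the
    -- kernel onto the complement, so $\Phi k=b-\Phi x$ has a solution in the kernel, and $x+k$ is a
    -- preimage of `y`.
    obtain ⟨a, ha, b, hb, rfl⟩ := Submodule.exists_add_mem_mem_orthogonal
      (K := LinearMap.range T.toFun) y
    obtain ⟨⟨x, hx⟩, rfl⟩ := ha
    obtain ⟨⟨k, hk⟩, hk'⟩ := hφs ⟨b - Φ x, Submodule.sub_mem _ hb (hΦ x)⟩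
    obtain ⟨hkd, hk0⟩ := mem_kernel.1 hk
    have hk'' : Φ k = b - Φ x := congrArg Subtype.val hk'
    refine ⟨⟨x + k, T.domain.add_mem hx hkd⟩, ?_⟩
    refine (addBounded_apply T Φ (T.domain.add_mem hx hkd) _).trans ?_
    rw [map_add, hk'']
    have h3 : T ⟨x + k, T.domain.add_mem hx hkd⟩ = T ⟨x, hx⟩ + T ⟨k, hkd⟩ :=
      T.map_add ⟨x, hx⟩ ⟨k, hkd⟩
    rw [h3, hk0]
    simp only [LinearPMap.toFun_eq_coe]
    abel

end Fredholm

/-! ### Finite-rank perturbations, determinants and the analytic Fredholm alternative -/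

section FiniteRank

variable {H : Type*} [NormedAddCommGroup H] [InnerProductSpace ℂ H]

/-- `F` takes its values in a finite-dimensional subspace. -/
def IsFiniteRank (F : H →L[ℂ] H) : Prop :=
  ∃ W : Submodule ℂ H, FiniteDimensional ℂ W ∧ ∀ x, F x ∈ W

theorem IsFiniteRank.zero : IsFiniteRank (0 : H →L[ℂ] H) :=
  ⟨⊥, inferInstance, fun _ => Submodule.zero_mem _⟩

theorem IsFiniteRank.add {F G : H →L[ℂ] H} (hF : IsFiniteRank F) (hG : IsFiniteRank G) :
    IsFiniteRank (F + G) := by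
  obtain ⟨W, _, hW⟩ := hF
  obtain ⟨V, _, hV⟩ := hG
  exact ⟨W ⊔ V, inferInstance, fun x => Submodule.add_mem_sup (hW x) (hV x)⟩

theorem IsFiniteRank.smul {F : H →L[ℂ] H} (hF : IsFiniteRank F) (c : ℂ) :
    IsFiniteRank (c • F) := by
  obtain ⟨W, hfd, hW⟩ := hF
  exact ⟨W, hfd, fun x => W.smul_mem c (hW x)⟩

theorem IsFiniteRank.sub {F G : H →L[ℂ] H} (hF : IsFiniteRank F) (hG : IsFiniteRank G) :
    IsFiniteRank (F - G) := by
  have := hF.add (hG.smul (-1))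
  rwa [neg_one_smul, ← sub_eq_add_neg] at this

theorem IsFiniteRank.sum {ι : Type*} {s : Finset ι} {F : ι → H →L[ℂ] H}
    (hF : ∀ i ∈ s, IsFiniteRank (F i)) : IsFiniteRank (∑ i ∈ s, F i) :=
  Finset.sum_induction F IsFiniteRank (fun _ _ h h' => h.add h') .zero hF

theorem IsFiniteRank.mul_right {F : H →L[ℂ] H} (hF : IsFiniteRank F) (B : H →L[ℂ] H) :
    IsFiniteRank (F * B) := by
  obtain ⟨W, hfd, hW⟩ := hF
  exact ⟨W, hfd, fun x => hW (B x)⟩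

theorem IsFiniteRank.mul_left {F : H →L[ℂ] H} (hF : IsFiniteRank F) (B : H →L[ℂ] H) :
    IsFiniteRank (B * F) := by
  obtain ⟨W, hfd, hW⟩ := hF
  exact ⟨W.map B.toLinearMap, inferInstance, fun x => ⟨F x, hW x, rfl⟩⟩

theorem isFiniteRank_rankOne (u v : H) : IsFiniteRank (InnerProductSpace.rankOne ℂ u v) :=
  ⟨ℂ ∙ u, inferInstance, fun x => Submodule.mem_span_singleton.2 ⟨inner ℂ v x, by simp⟩⟩

/-- A finite-rank perturbation of the identity is invertible iff its determinant does not vanish. -/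
theorem isUnit_one_add_subtypeL_comp_iff {W : Submodule ℂ H} [FiniteDimensional ℂ W]
    (κ : H →L[ℂ] W) :
    IsUnit (1 + W.subtypeL ∘L κ : H →L[ℂ] H) ↔
      LinearMap.det (1 + (κ ∘L W.subtypeL : W →L[ℂ] W).toLinearMap) ≠ 0 := by
  -- With $\iota$ the inclusion of `W`, the operators $1+\iota\kappa$ and $1+\kappa\iota$ are
  -- invertible together: $(1+\kappa\iota)^{-1}=1-\kappa(1+\iota\kappa)^{-1}\iota$, and
  -- symmetrically.
  rw [← isUnit_iff_ne_zero, ← LinearMap.isUnit_iff_isUnit_det]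
  constructor
  · rintro ⟨u, hu⟩
    have h1 : ∀ x, (↑u⁻¹ : H →L[ℂ] H) x + κ ((↑u⁻¹ : H →L[ℂ] H) x) = x := fun x => by
      have := DFunLike.congr_fun u.mul_inv x
      rw [hu] at this
      exact this
    have h2 : ∀ x, (↑u⁻¹ : H →L[ℂ] H) (x + κ x) = x := fun x => by
      have := DFunLike.congr_fun u.inv_mul x
      rw [hu] at this
      exact this
    refine ⟨⟨_, 1 - (κ ∘L (↑u⁻¹ : H →L[ℂ] H) ∘L W.subtypeL).toLinearMap, ?_, ?_⟩, rfl⟩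
    · ext x
      have h3 := congrArg (fun y => (κ y : H)) (h1 x)
      change (((x : W) : H) - κ ((↑u⁻¹ : H →L[ℂ] H) x)) +
        κ (((x : W) : H) - κ ((↑u⁻¹ : H →L[ℂ] H) x)) = (x : H)
      simp only [map_add, Submodule.coe_add, map_sub, Submodule.coe_sub] at h3 ⊢
      rw [← h3]; abel
    · ext x
      have h3 := h2 x
      change ((x : W) : H) + κ x - κ ((↑u⁻¹ : H →L[ℂ] H) ((x : W) + κ x)) = (x : H)
      rw [h3]; abel
  · rintro ⟨u, hu⟩
    have h1 : ∀ x : W, (↑u⁻¹ : W →ₗ[ℂ] W) x + κ ((↑u⁻¹ : W →ₗ[ℂ] W) x : W) = x := fun x => by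
      have := DFunLike.congr_fun u.mul_inv x
      rw [hu] at this
      exact this
    have h2 : ∀ x : W, (↑u⁻¹ : W →ₗ[ℂ] W) (x + κ x) = x := fun x => by
      have := DFunLike.congr_fun u.inv_mul x
      rw [hu] at this
      exact this
    refine ⟨⟨_, 1 - W.subtypeL ∘L (LinearMap.toContinuousLinearMap (↑u⁻¹ : W →ₗ[ℂ] W)) ∘L κ,
      ?_, ?_⟩, rfl⟩
    · ext x
      have h3 := congrArg (Subtype.val) (h1 (κ x))
      change (x - ((↑u⁻¹ : W →ₗ[ℂ] W) (κ x) : H)) +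
        κ (x - ((↑u⁻¹ : W →ₗ[ℂ] W) (κ x) : H)) = x
      simp only [Submodule.coe_add, map_sub, Submodule.coe_sub] at h3 ⊢
      rw [← h3]; abel
    · ext x
      have h3 := congrArg Subtype.val (h2 (κ x))
      change x + (κ x : H) - ((↑u⁻¹ : W →ₗ[ℂ] W) (κ (x + κ x)) : H) = x
      rw [map_add, h3]; abel

/-- A zero `t` of the determinant is nonzero and $t^{-1}$ is an eigenvalue of $-f$, of which there
are finitely many. -/
theorem finite_setOf_det_one_add_smul_eq_zero {W : Type*} [AddCommGroup W] [Module ℂ W]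
    [FiniteDimensional ℂ W] (f : Module.End ℂ W) :
    {t : ℂ | LinearMap.det (1 + t • f) = 0}.Finite := by
  refine (Set.Finite.preimage inv_injective.injOn
    (Module.End.finite_hasEigenvalue (-f))).subset fun t ht => ?_
  rw [Set.mem_ofPred_eq] at ht
  have ht0 : t ≠ 0 := by
    rintro rfl
    simp at ht
  have h4 : algebraMap ℂ (Module.End ℂ W) t⁻¹ - -f = t⁻¹ • (1 + t • f) := by
    rw [smul_add, smul_smul, inv_mul_cancel₀ ht0, one_smul, sub_neg_eq_add,
      Algebra.algebraMap_eq_smul_one]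
  rw [Set.mem_preimage, Set.mem_ofPred_eq, Module.End.hasEigenvalue_iff_mem_spectrum,
    spectrum.mem_iff, LinearMap.isUnit_iff_isUnit_det, isUnit_iff_ne_zero, not_not, h4,
    LinearMap.det_smul, ht, mul_zero]

/-- Along a complex line in the direction of a finite-rank operator, all but finitely many
perturbations of an invertible operator are invertible. -/
theorem finite_setOf_not_isUnit_add_smul {C F : H →L[ℂ] H} (hC : IsUnit C) (hF : IsFiniteRank F) :
    {t : ℂ | ¬ IsUnit (C + t • F)}.Finite := by
  obtain ⟨u, rfl⟩ := hC
  obtain ⟨W, hfd, hW⟩ := hF.mul_right (↑u⁻¹ : H →L[ℂ] H)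
  let κ : H →L[ℂ] W := (F * (↑u⁻¹ : H →L[ℂ] H)).codRestrict W hW
  refine (finite_setOf_det_one_add_smul_eq_zero
    (κ ∘L W.subtypeL : W →L[ℂ] W).toLinearMap).subset fun t ht => ?_
  have h1 : (u : H →L[ℂ] H) + t • F = (1 + W.subtypeL ∘L (t • κ)) * u := by
    have h2 : W.subtypeL ∘L (t • κ) = t • (F * (↑u⁻¹ : H →L[ℂ] H)) := by
      ext x; rfl
    rw [h2, add_mul, one_mul, smul_mul_assoc, mul_assoc, u.inv_mul, mul_one]
  rw [Set.mem_ofPred_eq, h1, Units.isUnit_mul_units, isUnit_one_add_subtypeL_comp_iff,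
    not_not] at ht
  exact ht

variable [CompleteSpace H]

/-- The analytic Fredholm alternative near a point. -/
theorem eventually_not_isUnit_or_eventually_isUnit {V : ℂ → H →L[ℂ] H} {z₀ : ℂ}
    (hV : AnalyticAt ℂ V z₀) (hu : IsUnit (V z₀)) {F : H →L[ℂ] H} (hF : IsFiniteRank F) :
    (∀ᶠ z in 𝓝 z₀, ¬ IsUnit (V z + F)) ∨ ∀ᶠ z in 𝓝[≠] z₀, IsUnit (V z + F) := by
  obtain ⟨W, hfd, hW⟩ := hF
  let κ : H →L[ℂ] W := F.codRestrict W hW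
  let g : ℂ → H →L[ℂ] H := fun z => Ring.inverse (V z)
  have hg : AnalyticAt ℂ g z₀ := by
    obtain ⟨u, hu⟩ := hu
    refine AnalyticAt.fun_comp (g := Ring.inverse) ?_ hV
    rw [← hu]
    exact analyticAt_inverse u
  -- Where $V(z)$ is a unit, $V+F=(1+FV^{-1})V$, so invertibility is the nonvanishing of a
  -- determinant on `W`. It is analytic at $z_0$, hence locally zero or nonzero on a punctured
  -- neighbourhood.
  let d : ℂ → ℂ := fun z =>
    LinearMap.det (1 + ((κ ∘L g z) ∘L W.subtypeL : W →L[ℂ] W).toLinearMap)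
  have hd : AnalyticAt ℂ d z₀ := by
    let b := Module.finBasis ℂ W
    have h1 : d = fun z => (1 + LinearMap.toMatrix b b
        ((κ ∘L g z) ∘L W.subtypeL : W →L[ℂ] W).toLinearMap).det := by
      funext z
      simp only [d]
      rw [← LinearMap.det_toMatrix b, map_add, LinearMap.toMatrix_one]
    rw [h1]
    simp only [Matrix.det_apply]
    have h2 : ∀ i j, AnalyticAt ℂ (fun z => (1 + LinearMap.toMatrix b b
        ((κ ∘L g z) ∘L W.subtypeL : W →L[ℂ] W).toLinearMap) i j) z₀ := by
      intro i j
      simp only [Matrix.add_apply, LinearMap.toMatrix_apply]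
      refine analyticAt_const.add ?_
      let ℓ : H →L[ℂ] ℂ := (LinearMap.toContinuousLinearMap (b.coord i)) ∘L κ
      have h3 : AnalyticAt ℂ (fun z => (ContinuousLinearMap.apply ℂ H (b j : H)) (g z)) z₀ :=
        (ContinuousLinearMap.analyticAt _ _).fun_comp hg
      exact (ContinuousLinearMap.analyticAt ℓ _).fun_comp h3
    refine Finset.analyticAt_fun_sum _ fun σ _ => ?_
    simp only [Units.smul_def, zsmul_eq_mul]
    exact analyticAt_const.mul (Finset.analyticAt_fun_prod _ fun i _ => h2 _ _)
  have hev : ∀ᶠ z in 𝓝 z₀, (IsUnit (V z + F) ↔ d z ≠ 0) := by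
    filter_upwards [hV.continuousAt.eventually (Units.isOpen.mem_nhds hu)] with z hz
    obtain ⟨u, hu⟩ := (hz : IsUnit (V z))
    have h1 : V z + F = (1 + W.subtypeL ∘L (κ ∘L g z)) * u := by
      have h2 : W.subtypeL ∘L (κ ∘L g z) = F * (↑u⁻¹ : H →L[ℂ] H) := by
        have : g z = (↑u⁻¹ : H →L[ℂ] H) := by simp only [g, ← hu, Ring.inverse_unit]
        rw [this]
        ext x; rfl
      rw [h2, add_mul, one_mul, mul_assoc, u.inv_mul, mul_one, hu]
    rw [h1, Units.isUnit_mul_units, isUnit_one_add_subtypeL_comp_iff]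
  rcases hd.eventually_eq_zero_or_eventually_ne_zero with h | h
  · left
    filter_upwards [h, hev] with z h1 h2
    rw [h2, h1]; simp
  · right
    filter_upwards [h, hev.filter_mono nhdsWithin_le_nhds] with z h1 h2
    rw [h2]; exact h1

end FiniteRank

/-! ### The spectrum on a connected set of Fredholm points -/

section Spectrum

variable {H : Type*} [NormedAddCommGroup H] [InnerProductSpace ℂ H] [CompleteSpace H]

/-- An index-zero Fredholm operator has an invertible finite-rank perturbation. -/
theorem exists_isFiniteRank_hasInverse {T : H →ₗ.[ℂ] H} (hT : IsFredholm T)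
    (hi : fredholmIndex T = 0) :
    ∃ Φ G : H →L[ℂ] H, IsFiniteRank Φ ∧ HasInverse (addBounded T Φ) G := by
  obtain ⟨hfd, hrk⟩ := exists_linearEquiv_kernel hT hi
  have := finiteDimensional_kernel hT
  let e : kernel T ≃ₗ[ℂ] ((LinearMap.range T.toFun)ᗮ : Submodule ℂ H) :=
    LinearEquiv.ofFinrankEq _ _ hrk
  let Φ : H →L[ℂ] H := ((LinearMap.range T.toFun)ᗮ).subtypeL ∘L
    (LinearMap.toContinuousLinearMap e.toLinearMap) ∘L (kernel T).orthogonalProjectionOnto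
  have hΦ : ∀ x, Φ x ∈ (LinearMap.range T.toFun)ᗮ := fun x => Submodule.coe_mem _
  obtain ⟨G, hG⟩ := exists_hasInverse_addBounded hT Φ hΦ (fun x hx h => by
    have h1 : e ((kernel T).orthogonalProjectionOnto x) = 0 := Subtype.ext h
    rw [LinearEquiv.map_eq_zero_iff] at h1
    have h2 := (Submodule.starProjection_eq_self_iff (K := kernel T)).2 hx
    rw [← h2, Submodule.starProjection_apply, h1]
    rfl) hi
  exact ⟨Φ, G, ⟨_, hfd, hΦ⟩, hG⟩

/-- The spectrum of a perturbation of `A` by a limit of finite-rank operators is, near an index-zero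
Fredholm point of `A`, either everything or discrete. -/
theorem eventually_mem_spec_or_eventually_notMem_spec {A : H →ₗ.[ℂ] H} {z₀ : ℂ}
    (hz : z₀ ∈ fredholmDomainZero A) {Q : H →L[ℂ] H}
    (hQ : Q ∈ closure {F : H →L[ℂ] H | IsFiniteRank F}) :
    (∀ᶠ z in 𝓝 z₀, z ∈ spec (addBounded A Q)) ∨
      ∀ᶠ z in 𝓝[≠] z₀, z ∉ spec (addBounded A Q) := by
  obtain ⟨Φ, G, hΦ, hG⟩ := exists_isFiniteRank_hasInverse hz.1 hz.2
  -- The tolerance gives $\|(Q-F)G\|<1$, so $V(z_0)=1+(Q-F)G$ is a unit by the Neumann series; what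
  -- remains, $(F-\Phi)G$, has finite rank and does not depend on `z`.
  obtain ⟨F, hF, hFQ⟩ := Metric.mem_closure_iff.1 hQ (1 / (‖G‖ + 1)) (by positivity)
  let V : ℂ → H →L[ℂ] H := fun z => 1 + (Q - F - (z - z₀) • 1) * G
  have hVa : AnalyticAt ℂ V z₀ := by
    have : V = fun z => (1 + (Q - F) * G) - (z - z₀) • G := by
      funext z
      simp only [V, sub_mul, smul_mul_assoc, one_mul]
      abel
    rw [this]
    fun_prop
  have hVu : IsUnit (V z₀) := by
    have h1 : V z₀ = 1 - (-((Q - F) * G)) := by simp [V]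
    rw [h1]
    refine isUnit_one_sub_of_norm_lt_one ?_
    rw [norm_neg]
    rw [dist_eq_norm] at hFQ
    calc ‖(Q - F) * G‖ ≤ ‖Q - F‖ * ‖G‖ := norm_mul_le _ _
      _ ≤ 1 / (‖G‖ + 1) * ‖G‖ := by gcongr
      _ < 1 := by rw [div_mul_eq_mul_div, one_mul, div_lt_one (by positivity)]; linarith
  have hmem : ∀ z, z ∉ spec (addBounded A Q) ↔ IsUnit (V z + (F - Φ) * G) := by
    intro z
    rw [notMem_spec_iff, shift_addBounded A Φ Q z₀ z, hG.exists_iff]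
    have : V z + (F - Φ) * G = 1 + (Q - Φ - (z - z₀) • 1) * G := by
      simp only [V, sub_mul]
      abel
    rw [this]
  have := eventually_not_isUnit_or_eventually_isUnit hVa hVu ((hF.sub hΦ).mul_right G)
  simpa only [← hmem, not_not] using this

/-- On a connected set of index-zero Fredholm points of `A`, the spectrum of `A + Q` has no
accumulation point unless it is everything. -/
theorem eventually_notMem_spec {A : H →ₗ.[ℂ] H} {D : Set ℂ}
    (hDc : IsPreconnected D) (hD : D ⊆ fredholmDomainZero A) {Q : H →L[ℂ] H}
    (hQ : Q ∈ closure {F : H →L[ℂ] H | IsFiniteRank F}) {w : ℂ} (hw : w ∈ D)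
    (hwQ : w ∉ spec (addBounded A Q)) {z : ℂ} (hz : z ∈ D) :
    ∀ᶠ z' in 𝓝[≠] z, z' ∉ spec (addBounded A Q) := by
  let S := spec (addBounded A Q)
  have hdich := fun z (hz : z ∈ D) =>
    eventually_mem_spec_or_eventually_notMem_spec (hD hz) hQ
  by_contra hcon
  -- `D` is covered by two open sets: points near which everything is spectrum, and points with a
  -- punctured neighbourhood free of spectrum. Under `hcon` the first contains `z`, while the second
  -- contains `w`; connectedness yields a common point, which is absurd.
  have hU : IsOpen {z | ∀ᶠ z' in 𝓝 z, z' ∈ S} := isOpen_setOfPred_eventually_nhds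
  have hV : IsOpen {z | ∀ᶠ z' in 𝓝[≠] z, z' ∉ S} := by
    have : {z | ∀ᶠ z' in 𝓝[≠] z, z' ∉ S} = {z | ∀ᶠ z' in 𝓝 z, ∀ᶠ y in 𝓝[≠] z', y ∉ S} := by
      ext z
      simp only [Set.mem_ofPred_eq]
      constructor
      · intro h
        have h0 := h
        rw [← eventually_eventually_nhdsWithin] at h
        rw [eventually_nhdsWithin_iff] at h
        filter_upwards [h] with z' hz'
        by_cases hzz : z' = z
        · rw [hzz]
          exact h0
        · have := hz' hzz
          rw [IsOpen.nhdsWithin_eq isOpen_compl_singleton hzz] at this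
          exact this.filter_mono nhdsWithin_le_nhds
      · exact fun h => h.self_of_nhds
    rw [this]
    exact isOpen_setOfPred_eventually_nhds
  obtain ⟨y, hyD, hy1, hy2⟩ := hDc _ _ hU hV (fun z hz => hdich z hz)
    ⟨z, hz, (hdich z hz).resolve_right hcon⟩
    ⟨w, hw, (hdich w hw).resolve_left fun h => hwQ h.self_of_nhds⟩
  have hy3 : ∀ᶠ z' in 𝓝[≠] y, z' ∈ S := hy1.filter_mono nhdsWithin_le_nhds
  obtain ⟨x, hx1, hx2⟩ := (hy3.and hy2).exists
  exact hx2 hx1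

theorem isDiscrete_of_eventually_notMem {X : Type*} [TopologicalSpace X] {S D : Set X}
    (h : ∀ x ∈ D, ∀ᶠ y in 𝓝[≠] x, y ∉ S) : IsDiscrete (S ∩ D) := by
  refine ⟨discreteTopology_subtype_iff.2 fun x hx => ?_⟩
  have h1 : 𝓝[≠] x ⊓ 𝓟 S = ⊥ := by
    rw [inf_principal_eq_bot]
    exact h x hx.2
  rw [eq_bot_iff, ← h1]
  exact inf_le_inf_left _ (principal_mono.2 Set.inter_subset_left)

end Spectrum

/-! ### A truncation that makes the operator invertible -/

section Generic

/-- Injectivity means linear independence of the images of a basis, an open condition on finitely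
many vectors, so pointwise convergence suffices. It lets finite sections of a Hilbert basis replace
the identity on kernel and cokernel. -/
theorem eventually_injective_of_tendsto {E F : Type*} [AddCommGroup E] [Module ℂ E]
    [FiniteDimensional ℂ E] [NormedAddCommGroup F] [NormedSpace ℂ F] {α : Type*} {l : Filter α}
    {f : α → E →ₗ[ℂ] F} {g : E →ₗ[ℂ] F} (hg : Function.Injective g)
    (hf : ∀ x, Tendsto (fun n => f n x) l (𝓝 (g x))) :
    ∀ᶠ n in l, Function.Injective (f n) := by
  let b := Module.finBasis ℂ E
  have h1 : LinearIndependent ℂ (fun i => g (b i)) :=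
    b.linearIndependent.map' g (LinearMap.ker_eq_bot.2 hg)
  have h2 : Tendsto (fun n i => f n (b i)) l (𝓝 fun i => g (b i)) :=
    tendsto_pi_nhds.2 fun i => hf _
  filter_upwards [h2.eventually h1.eventually] with n hn
  rw [← LinearMap.ker_eq_bot, LinearMap.ker_eq_bot']
  intro x hx
  rw [← b.sum_repr x, map_sum] at hx
  simp only [map_smul] at hx
  have h3 := Fintype.linearIndependent_iff.1 hn _ hx
  rw [← b.sum_repr x]
  simp [h3]

variable {H : Type*} [NormedAddCommGroup H] [InnerProductSpace ℂ H]

theorem truncation_apply (e₁ e₂ : HilbertBasis ℕ ℂ H) (S₁ S₂ : H →L[ℂ] H) (a : ℕ → ℕ → ℂ) (n : ℕ)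
    (x : H) : truncation e₁ e₂ S₁ S₂ a n x =
      ∑ j ∈ Finset.range n, ∑ k ∈ Finset.range n,
        (a j k * inner ℂ (e₂ k) (S₂ x)) • S₁ (e₁ j) := by
  simp [truncation, map_sum, mul_smul]

theorem truncation_eq_sum (e₁ e₂ : HilbertBasis ℕ ℂ H) (S₁ S₂ : H →L[ℂ] H) (a : ℕ → ℕ → ℂ)
    (n : ℕ) : truncation e₁ e₂ S₁ S₂ a n = ∑ p ∈ Finset.range n ×ˢ Finset.range n,
      a p.1 p.2 • (S₁ ∘L InnerProductSpace.rankOne ℂ (e₁ p.1) (e₂ p.2) ∘L S₂) := by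
  ext x
  rw [truncation_apply, Finset.sum_product]
  simp [mul_smul]

theorem truncation_smul (e₁ e₂ : HilbertBasis ℕ ℂ H) (S₁ S₂ : H →L[ℂ] H) (s : ℂ)
    (a : ℕ → ℕ → ℂ) (n : ℕ) : truncation e₁ e₂ S₁ S₂ (fun j k => s * a j k) n =
      s • truncation e₁ e₂ S₁ S₂ a n := by
  simp only [truncation_eq_sum, Finset.smul_sum, smul_smul]

theorem isFiniteRank_comp_rankOne_comp (S₁ S₂ : H →L[ℂ] H) (u v : H) :
    IsFiniteRank (S₁ ∘L InnerProductSpace.rankOne ℂ u v ∘L S₂) :=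
  ((isFiniteRank_rankOne u v).mul_right S₂).mul_left S₁

theorem isFiniteRank_truncation (e₁ e₂ : HilbertBasis ℕ ℂ H) (S₁ S₂ : H →L[ℂ] H)
    (a : ℕ → ℕ → ℂ) (n : ℕ) : IsFiniteRank (truncation e₁ e₂ S₁ S₂ a n) := by
  rw [truncation_eq_sum]
  exact .sum fun p _ => (isFiniteRank_comp_rankOne_comp _ _ _ _).smul _

/-- The projection onto the span of the first `n` vectors of a Hilbert basis. -/
def partialSum (e : HilbertBasis ℕ ℂ H) (n : ℕ) : H →ₗ[ℂ] H :=
  ∑ i ∈ Finset.range n, (InnerProductSpace.rankOne ℂ (e i) (e i) : H →L[ℂ] H).toLinearMap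

theorem partialSum_apply (e : HilbertBasis ℕ ℂ H) (n : ℕ) (x : H) :
    partialSum e n x = ∑ i ∈ Finset.range n, inner ℂ (e i) x • e i := by
  simp [partialSum]

theorem tendsto_partialSum (e : HilbertBasis ℕ ℂ H) (x : H) :
    Tendsto (fun n => partialSum e n x) atTop (𝓝 x) := by
  have := (e.hasSum_repr x).tendsto_sum_nat
  simpa only [partialSum_apply, HilbertBasis.repr_apply_apply] using this

variable [CompleteSpace H]

/-- If the compression of `X` from the kernel to the cokernel of `T` is injective, then `T + s X` is
invertible for all small `s ≠ 0`. -/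
theorem exists_hasInverse_addBounded_smul {T : H →ₗ.[ℂ] H} (hT : IsFredholm T)
    (hi : fredholmIndex T = 0) (X : H →L[ℂ] H)
    (hX : ∀ k ∈ kernel T, X k ∈ (LinearMap.range T.toFun)ᗮᗮ → k = 0) :
    ∃ s : ℂ, ∃ R, HasInverse (addBounded T (s • X)) R := by
  let C := (LinearMap.range T.toFun)ᗮ
  let p : H →L[ℂ] H := C.starProjection
  have hp : ∀ x, p x ∈ C := fun x => C.starProjection_apply_mem x
  have hpp : p * p = p := by
    ext x
    exact Submodule.starProjection_eq_self_iff.2 (hp x)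
  obtain ⟨G, hG⟩ := exists_hasInverse_addBounded hT (p * X) (fun x => hp _) (fun k hk h => by
    refine hX k hk ?_
    exact (Submodule.starProjection_apply_eq_zero_iff C).1 h) hi
  -- The projection `p` kills the range of `T`; applying it to $(T+pX)G=1$ leaves $pXG=p$.
  have hpG : p * X * G = p := by
    ext y
    obtain ⟨hy, hy'⟩ := hG.1 y
    have hy0 : G y ∈ T.domain := hy
    rw [addBounded_apply T (p * X) hy0] at hy'
    have h1 : p (T ⟨G y, hy0⟩) = 0 := by
      refine (Submodule.starProjection_apply_eq_zero_iff C).2 ?_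
      exact Submodule.le_orthogonal_orthogonal _ ⟨⟨G y, hy0⟩, rfl⟩
    have h2 := congrArg p hy'
    rw [map_add, h1, add_zero] at h2
    rw [← h2]
    have h3 := DFunLike.congr_fun hpp (X (G y))
    exact h3.symm
  let q : H →L[ℂ] H := 1 - p
  have hpq : p * q = 0 := by simp [q, mul_sub, hpp]
  have hqp : q * p = 0 := by simp [q, sub_mul, hpp]
  have hqq : q * q = q := by simp [q, mul_sub, sub_mul, hpp]
  let Y : H →L[ℂ] H := q * X * G
  -- `Y` starts with `q` and $pq=0$, so $Yp$ squares to zero and $1+Yp$ is a unit with inverse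
  -- $1-Yp$.
  have hnil : (Y * p) * (Y * p) = 0 := by
    have : (Y * p) * (Y * p) = Y * (p * q) * X * G * p := by simp only [Y, mul_assoc]
    rw [this, hpq]; simp
  have hu0 : IsUnit (1 + Y * p) := by
    refine ⟨⟨1 + Y * p, 1 - Y * p, ?_, ?_⟩, rfl⟩
    · rw [show (1 + Y * p) * (1 - Y * p) = 1 - Y * p * (Y * p) by noncomm_ring, hnil, sub_zero]
    · rw [show (1 - Y * p) * (1 + Y * p) = 1 - Y * p * (Y * p) by noncomm_ring, hnil, sub_zero]
  have hcont : Tendsto (fun s : ℂ => 1 + Y * p + s • (Y * q)) (𝓝 0) (𝓝 (1 + Y * p)) := by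
    have : Continuous (fun s : ℂ => 1 + Y * p + s • (Y * q)) := by fun_prop
    simpa using this.tendsto 0
  have hev := hcont.eventually (Units.isOpen.mem_nhds hu0)
  have hev' : ∀ᶠ s : ℂ in 𝓝[≠] 0, IsUnit (1 + Y * p + s • (Y * q)) :=
    hev.filter_mono nhdsWithin_le_nhds
  obtain ⟨s, hs, hs0⟩ := (hev'.and self_mem_nhdsWithin).exists
  have hs0 : s ≠ 0 := hs0
  refine ⟨s, ?_⟩
  have h1 : addBounded T (s • X) = addBounded (addBounded T (p * X)) (s • X - p * X) := by
    rw [addBounded_addBounded]; congr 1; abel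
  rw [h1, hG.exists_iff]
  have hu1 : IsUnit (q + s • p) := by
    refine ⟨⟨q + s • p, q + s⁻¹ • p, ?_, ?_⟩, rfl⟩ <;>
    · simp only [mul_add, add_mul, mul_smul_comm, smul_mul_assoc, hqq, hpp, hpq, hqp, smul_zero,
        zero_add, add_zero, smul_smul, mul_inv_cancel₀ hs0, inv_mul_cancel₀ hs0, one_smul]
      simp [q]
  -- Since $XG=p+Y$, the left side is $q+s(p+Y)$. Splitting off the unit $q+sp$ leaves a small
  -- perturbation of the unit $1+Yp$.
  have h2 : 1 + (s • X - p * X) * G = (1 + Y * p + s • (Y * q)) * (q + s • p) := by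
    have e1 : X * G = p + Y := by
      simp only [Y, q, sub_mul, one_mul, hpG]; abel
    have e2 : (1 + Y * p + s • (Y * q)) * (q + s • p) =
        q + s • p + (Y * (p * q) + s • (Y * (p * p)) + s • (Y * (q * q)) +
          s • s • (Y * (q * p))) := by
      simp only [mul_add, add_mul, mul_smul_comm, smul_mul_assoc, mul_assoc, one_mul, smul_add]
      abel
    rw [e2, hpq, hpp, hqq, hqp, sub_mul, hpG, smul_mul_assoc, e1]
    simp only [q, mul_sub, mul_one, mul_zero, smul_zero, zero_add, add_zero, smul_add, smul_sub]
    abel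
  rw [h2]
  exact hs.mul hu1

/-- If `S₂` is injective on the kernel of `T` and the adjoint of `S₁` is injective on the complement
of its range, then some truncation makes `T` invertible. -/
theorem exists_truncation_hasInverse {T : H →ₗ.[ℂ] H} (hT : IsFredholm T)
    (hi : fredholmIndex T = 0) (e₁ e₂ : HilbertBasis ℕ ℂ H) (S₁ S₂ : H →L[ℂ] H)
    (h₁ : ∀ c ∈ (LinearMap.range T.toFun)ᗮ, ContinuousLinearMap.adjoint S₁ c = 0 → c = 0)
    (h₂ : ∀ k ∈ kernel T, S₂ k = 0 → k = 0) :
    ∃ (n : ℕ) (a : ℕ → ℕ → ℂ) (R : H →L[ℂ] H),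
      HasInverse (addBounded T (truncation e₁ e₂ S₁ S₂ a n)) R := by
  obtain ⟨hfd, hrk⟩ := exists_linearEquiv_kernel hT hi
  have := finiteDimensional_kernel hT
  let C := (LinearMap.range T.toFun)ᗮ
  let e : kernel T ≃ₗ[ℂ] C := LinearEquiv.ofFinrankEq _ _ hrk
  let g₂ : kernel T →ₗ[ℂ] H := S₂.toLinearMap ∘ₗ (kernel T).subtype
  let g₁ : C →ₗ[ℂ] H := (ContinuousLinearMap.adjoint S₁).toLinearMap ∘ₗ C.subtype
  have hg₂ : Function.Injective g₂ := by
    rw [← LinearMap.ker_eq_bot, LinearMap.ker_eq_bot']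
    exact fun x hx => Subtype.ext (h₂ x x.2 hx)
  have hg₁ : Function.Injective g₁ := by
    rw [← LinearMap.ker_eq_bot, LinearMap.ker_eq_bot']
    exact fun x hx => Subtype.ext (h₁ x x.2 hx)
  have hev₂ := eventually_injective_of_tendsto (f := fun n => partialSum e₂ n ∘ₗ g₂) hg₂
    (fun x => tendsto_partialSum e₂ _)
  have hev₁ := eventually_injective_of_tendsto (f := fun n => partialSum e₁ n ∘ₗ g₁) hg₁
    (fun x => tendsto_partialSum e₁ _)
  obtain ⟨n, hn₂, hn₁⟩ := (hev₂.and hev₁).exists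
  obtain ⟨g, hg⟩ := LinearMap.exists_leftInverse_of_injective _ (LinearMap.ker_eq_bot.2 hn₂)
  -- `L` sends $P_2S_2k$ to $S_1^*(ek)$, where $P_1,P_2$ are the projections onto the first `n`
  -- basis vectors. Taking its matrix entries as coefficients makes the truncation act on the kernel
  -- as $k\mapsto S_1P_1S_1^*(ek)$.
  let L : H →ₗ[ℂ] H := g₁ ∘ₗ e.toLinearMap ∘ₗ g
  have hL : ∀ k, L (partialSum e₂ n (g₂ k)) = g₁ (e k) := fun k => by
    have := DFunLike.congr_fun hg k
    change g₁ (e (g (partialSum e₂ n (g₂ k)))) = _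
    exact congrArg (fun x => g₁ (e x)) this
  let a : ℕ → ℕ → ℂ := fun j k => inner ℂ (e₁ j) (L (e₂ k))
  have ha : ∀ k : kernel T, truncation e₁ e₂ S₁ S₂ a n k = S₁ (partialSum e₁ n (g₁ (e k))) := by
    intro k
    rw [truncation_apply, partialSum_apply, map_sum]
    refine Finset.sum_congr rfl fun j _ => ?_
    rw [map_smul, ← Finset.sum_smul]
    congr 1
    rw [← hL k, partialSum_apply, map_sum, inner_sum]
    refine Finset.sum_congr rfl fun i _ => ?_
    rw [map_smul, inner_smul_right, mul_comm]
    rfl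
  obtain ⟨s, hs⟩ := exists_hasInverse_addBounded_smul hT hi (truncation e₁ e₂ S₁ S₂ a n) (by
    intro k hk hX
    -- Pairing with $ek$ itself gives $\|P_1S_1^*(ek)\|^2$, which vanishes only for $k=0$ by the
    -- choice of `n`.
    have h3 := Submodule.inner_right_of_mem_orthogonal (e ⟨k, hk⟩).2 hX
    rw [ha ⟨k, hk⟩, ← ContinuousLinearMap.adjoint_inner_left] at h3
    have h4 : ContinuousLinearMap.adjoint S₁ (e ⟨k, hk⟩ : H) = g₁ (e ⟨k, hk⟩) := rfl
    rw [h4, partialSum_apply, inner_sum] at h3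
    have h5 : ∀ i, inner ℂ (g₁ (e ⟨k, hk⟩)) (inner ℂ (e₁ i) (g₁ (e ⟨k, hk⟩)) • e₁ i) =
        ((‖inner ℂ (e₁ i) (g₁ (e ⟨k, hk⟩))‖ ^ 2 : ℝ) : ℂ) := fun i => by
      rw [inner_smul_right, ← inner_conj_symm (g₁ (e ⟨k, hk⟩)) (e₁ i), RCLike.mul_conj]
      simp
    simp only [h5] at h3
    rw [← Complex.ofReal_sum, Complex.ofReal_eq_zero,
      Finset.sum_eq_zero_iff_of_nonneg (fun _ _ => by positivity)] at h3
    have h6 : partialSum e₁ n (g₁ (e ⟨k, hk⟩)) = 0 := by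
      rw [partialSum_apply]
      refine Finset.sum_eq_zero fun i hi => ?_
      have := h3 i hi
      rw [sq_eq_zero_iff, norm_eq_zero] at this
      rw [this, zero_smul]
    have h7 : e ⟨k, hk⟩ = 0 := hn₁ (by simpa using h6)
    rw [LinearEquiv.map_eq_zero_iff] at h7
    exact congrArg Subtype.val h7)
  refine ⟨n, fun j k => s * a j k, ?_⟩
  rw [truncation_smul]
  exact hs

/-- The kernel of `A - z` lies in the low-lying spectral space of `(A - z)^* (A - z)`. -/
theorem mem_lowSpace_rightSquare {A : H →ₗ.[ℂ] H} {z : ℂ} {α : ℝ} (hα : 0 < α) {k : H}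
    (hk : k ∈ kernel (shift A z)) : k ∈ lowSpace (rightSquare A z) α := by
  obtain ⟨hk1, hk2⟩ := mem_kernel.1 hk
  refine Submodule.subset_span ⟨0, hα, ⟨hk1, ?_⟩, ?_⟩
  · rw [hk2]
    exact Submodule.zero_mem _
  · change (shift A z).adjoint ⟨shift A z ⟨k, _⟩, _⟩ = _
    simp only [hk2, Complex.ofReal_zero, zero_smul]
    exact LinearPMap.map_zero _

/-- The complement of the range of `A - z` lies in the low-lying spectral space of
`(A - z) (A - z)^*`. -/
theorem mem_lowSpace_leftSquare {A : H →ₗ.[ℂ] H} {z : ℂ} {α : ℝ} (hα : 0 < α)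
    (hd : Dense ((shift A z).domain : Set H)) {c : H}
    (hc : c ∈ (LinearMap.range (shift A z).toFun)ᗮ) : c ∈ lowSpace (leftSquare A z) α := by
  have h0 : ∀ x : (shift A z).domain, inner ℂ (0 : H) x = inner ℂ c (shift A z x) := fun x => by
    rw [inner_zero_left, eq_comm]
    exact Submodule.inner_left_of_mem_orthogonal (⟨x, rfl⟩ : _ ∈ LinearMap.range _) hc
  have hc1 : c ∈ (shift A z).adjoint.domain := LinearPMap.mem_adjoint_domain_of_exists _ ⟨0, h0⟩
  have hc2 : (shift A z).adjoint ⟨c, hc1⟩ = 0 := LinearPMap.adjoint_apply_eq hd _ h0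
  refine Submodule.subset_span ⟨0, hα, ⟨hc1, ?_⟩, ?_⟩
  · rw [hc2]
    exact Submodule.zero_mem _
  · change shift A z ⟨(shift A z).adjoint ⟨c, _⟩, _⟩ = _
    simp only [hc2, Complex.ofReal_zero, zero_smul]
    exact LinearPMap.map_zero _

end Generic

/-! ### Null sets of bad coefficients in finitely many variables -/

section NullSets

open scoped Classical in
/-- A measurable subset of a product of atomless measures is null if it misses a point and meets each
coordinate line in a finite set or contains it. -/
theorem measure_pi_eq_zero_of_finite_lines {ι : Type*} [Fintype ι] {γ : Measure ℂ} [SigmaFinite γ]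
    [NullSingletonClass γ] {Z : Set (ι → ℂ)} (hZ : MeasurableSet Z) {a : ι → ℂ} (ha : a ∉ Z)
    (hline : ∀ x i, x ∉ Z → {t | Function.update x i t ∈ Z}.Finite) :
    Measure.pi (fun _ => γ) Z = 0 := by
  have hmeas : ∀ s : Finset ι, Measurable (fun x : ι → ℂ => s.piecewise x a) := fun s => by
    refine measurable_pi_lambda _ fun i => ?_
    by_cases hi : i ∈ s
    · simpa [Finset.piecewise, hi] using measurable_pi_apply i
    · simp [Finset.piecewise, hi]
  -- The coordinates of the good point `a` are replaced by random ones one at a time.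
  have key : ∀ s : Finset ι, Measure.pi (fun _ => γ) {x : ι → ℂ | s.piecewise x a ∈ Z} = 0 := by
    intro s
    induction s using Finset.induction_on with
    | empty => simp [ha]
    | insert i s hi ih =>
      -- `Z₁` collects the points that become bad only when coordinate `i` is freed. Each line in
      -- direction `i` meets it in a finite set, so it is null by Fubini.
      let Z₁ : Set (ι → ℂ) := {x | (insert i s).piecewise x a ∈ Z} \ {x | s.piecewise x a ∈ Z}
      have hZ₁ : MeasurableSet Z₁ := (hmeas _ hZ).diff (hmeas _ hZ)
      have h0 : Measure.pi (fun _ => γ) Z₁ = 0 := by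
        rw [← lintegral_indicator_one hZ₁, ← lintegral_zero (μ := Measure.pi fun _ : ι => γ)]
        refine lintegral_eq_of_lmarginal_eq {i} (measurable_one.indicator hZ₁)
          measurable_const ?_
        funext x
        rw [lmarginal_singleton, lmarginal_singleton, lintegral_zero]
        have hup : ∀ t, s.piecewise (Function.update x i t) a = s.piecewise x a := fun t => by
          ext j
          by_cases hj : j ∈ s
          · have : j ≠ i := by rintro rfl; exact hi hj
            simp [Finset.piecewise, hj, this]
          · simp [Finset.piecewise, hj]
        have hup' : ∀ t, (insert i s).piecewise (Function.update x i t) a =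
            Function.update (s.piecewise x a) i t := fun t => by
          rw [Finset.piecewise_insert, hup]
          simp
        have hfin : {t : ℂ | Function.update x i t ∈ Z₁}.Finite := by
          by_cases hx : s.piecewise x a ∈ Z
          · have : {t : ℂ | Function.update x i t ∈ Z₁} = ∅ := by
              ext t; simp [Z₁, hup, hx]
            rw [this]; exact Set.finite_empty
          · refine (hline _ i hx).subset fun t ht => ?_
            have := ht.1
            simpa only [Set.mem_ofPred_eq, hup'] using this
        have h1 : ∀ᵐ t ∂γ, t ∉ {t : ℂ | Function.update x i t ∈ Z₁} :=
          compl_mem_ae_iff.2 (hfin.measure_zero γ)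
        refine (lintegral_congr_ae ?_).trans lintegral_zero
        filter_upwards [h1] with t ht
        exact Set.indicator_of_notMem ht _
      have : {x : ι → ℂ | (insert i s).piecewise x a ∈ Z} ⊆
          Z₁ ∪ {x | s.piecewise x a ∈ Z} := fun x hx => by
        by_cases h : x ∈ {x | s.piecewise x a ∈ Z}
        · exact Or.inr h
        · exact Or.inl ⟨hx, h⟩
      exact measure_mono_null this (measure_union_null h0 ih)
  have := key Finset.univ
  simpa using this

variable {H : Type*} [NormedAddCommGroup H] [InnerProductSpace ℂ H] [CompleteSpace H]

/-- Random finite-rank perturbations with independent atomless coefficients are almost surely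
invertible if one of them is. -/
theorem measure_pi_setOf_not_isUnit {ι : Type*} [Fintype ι] {γ : Measure ℂ} [SigmaFinite γ]
    [NullSingletonClass γ] (C : H →L[ℂ] H) (F : ι → H →L[ℂ] H) (hF : ∀ i, IsFiniteRank (F i)) {a : ι → ℂ}
    (ha : IsUnit (C + ∑ i, a i • F i)) :
    Measure.pi (fun _ => γ) {x : ι → ℂ | ¬ IsUnit (C + ∑ i, x i • F i)} = 0 := by
  classical
  have hc : Continuous fun x : ι → ℂ => C + ∑ i, x i • F i := by fun_prop
  refine measure_pi_eq_zero_of_finite_lines (a := a) ?_ (by simpa using ha) ?_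
  · exact ((Units.isOpen.preimage hc).measurableSet).compl
  · intro x i hx
    simp only [Set.mem_ofPred_eq, not_not] at hx
    -- Moving coordinate `i` from `x i` to `t` adds $(t-x_i)F_i$, whence the translation by `x i`.
    refine (((finite_setOf_not_isUnit_add_smul hx (hF i)).preimage
      (sub_left_injective (b := x i)).injOn)).subset fun t ht => ?_
    simp only [Set.mem_preimage, Set.mem_ofPred_eq] at ht ⊢
    convert! ht using 2
    rw [add_assoc]
    congr 1
    rw [← Finset.add_sum_erase _ _ (Finset.mem_univ i), ← Finset.add_sum_erase _ (fun j =>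
      Function.update x i t j • F j) (Finset.mem_univ i)]
    have : ∑ j ∈ Finset.univ.erase i, Function.update x i t j • F j =
        ∑ j ∈ Finset.univ.erase i, x j • F j :=
      Finset.sum_congr rfl fun j hj => by
        rw [Function.update_of_ne (Finset.ne_of_mem_erase hj)]
    rw [this, Function.update_self, sub_smul]
    abel

end NullSets

/-! ### Moments of the complex Gaussian law -/

section Gaussian

instance : NullSingletonClass stdComplexGaussian := by
  unfold stdComplexGaussian
  infer_instance

theorem integrable_norm_sq_stdComplexGaussian :
    Integrable (fun z : ℂ => ‖z‖ ^ 2) stdComplexGaussian := by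
  have h1 : Integrable (fun z : ℂ => Real.exp (-(1 / 2) * ‖z‖ ^ 2)) := by
    refine Integrable.of_integral_ne_zero ?_
    rw [GaussianFourier.integral_rexp_neg_mul_sq_norm (by norm_num)]
    positivity
  unfold stdComplexGaussian
  rw [integrable_withDensity_iff (by fun_prop) (by simp)]
  refine (h1.const_mul (2 / Real.pi)).mono' (by fun_prop) (ae_of_all _ fun z => ?_)
  rw [ENNReal.toReal_ofReal (by positivity), Real.norm_of_nonneg (by positivity)]
  have h2 : ‖z‖ ^ 2 ≤ 2 * Real.exp (1 / 2 * ‖z‖ ^ 2) := by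
    have := Real.add_one_le_exp (1 / 2 * ‖z‖ ^ 2)
    linarith
  have h3 : Real.exp (-‖z‖ ^ 2) = Real.exp (-(1 / 2) * ‖z‖ ^ 2) * Real.exp (-(1 / 2) * ‖z‖ ^ 2) := by
    rw [← Real.exp_add]; congr 1; ring
  have h4 : Real.exp (1 / 2 * ‖z‖ ^ 2) * Real.exp (-(1 / 2) * ‖z‖ ^ 2) = 1 := by
    rw [← Real.exp_add]; simp
  calc ‖z‖ ^ 2 * (Real.exp (-‖z‖ ^ 2) / Real.pi)
      ≤ 2 * Real.exp (1 / 2 * ‖z‖ ^ 2) * (Real.exp (-‖z‖ ^ 2) / Real.pi) := by gcongr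
    _ = 2 / Real.pi * (Real.exp (1 / 2 * ‖z‖ ^ 2) * Real.exp (-(1 / 2) * ‖z‖ ^ 2)) *
        Real.exp (-(1 / 2) * ‖z‖ ^ 2) := by rw [h3]; ring
    _ = 2 / Real.pi * Real.exp (-(1 / 2) * ‖z‖ ^ 2) := by rw [h4, mul_one]

/-- The density is even, so the mean equals its own negative. -/
theorem integral_id_stdComplexGaussian : ∫ z, z ∂stdComplexGaussian = 0 := by
  have h : MeasurePreserving (fun z : ℂ => -z) stdComplexGaussian stdComplexGaussian := by
    refine ⟨measurable_neg, ?_⟩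
    ext s hs
    rw [Measure.map_apply measurable_neg hs]
    unfold stdComplexGaussian
    rw [withDensity_apply _ (measurable_neg hs), withDensity_apply _ hs]
    have := (Measure.measurePreserving_neg (volume : Measure ℂ)).setLIntegral_comp_preimage hs
      (f := fun z : ℂ => ENNReal.ofReal (Real.exp (-‖z‖ ^ 2) / Real.pi)) (by fun_prop)
    rw [← this]
    simp
  have h1 := h.integral_comp (MeasurableEquiv.neg ℂ).measurableEmbedding (fun z : ℂ => z)
  rw [integral_neg] at h1
  exact self_eq_neg.1 h1.symm

end Gaussian

/-! ### Random series in a Hilbert space -/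

section RandomSeries

theorem inner_sum_smul_sum_smul {I K : Type*} [NormedAddCommGroup K] [InnerProductSpace ℂ K]
    (x : I → ℂ) (y : I → K) (A B : Finset I) :
    inner ℂ (∑ i ∈ A, x i • y i) (∑ j ∈ B, x j • y j) =
      ∑ i ∈ A, ∑ j ∈ B, inner ℂ (y i) (y j) * (star (x i) * x j) := by
  rw [sum_inner]
  refine Finset.sum_congr rfl fun i _ => ?_
  rw [inner_sum]
  refine Finset.sum_congr rfl fun j _ => ?_
  rw [inner_smul_left, inner_smul_right, starRingEnd_apply]
  ring

variable {Ω : Type*} [MeasurableSpace Ω] {P : Measure Ω}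
  {I : Type*} {ξ : I → Ω → ℂ} {K : Type*} [NormedAddCommGroup K] [InnerProductSpace ℂ K]

/-- The filtration generated by the variables with index in an increasing family of finite sets. -/
def finsetFiltration (hm : ∀ i, Measurable (ξ i)) (F : ℕ → Finset I) (hF : Monotone F) :
    Filtration ℕ (inferInstance : MeasurableSpace Ω) where
  seq n := ⨆ i ∈ (F n : Set I), MeasurableSpace.comap (ξ i) inferInstance
  mono' _ _ h := biSup_mono fun _ hi => hF h hi
  le' _ := iSup₂_le fun i _ => (hm i).comap_le

theorem measurable_finsetFiltration (hm : ∀ i, Measurable (ξ i)) (F : ℕ → Finset I)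
    (hF : Monotone F) {n : ℕ} {i : I} (hi : i ∈ F n) :
    Measurable[finsetFiltration hm F hF n] (ξ i) := by
  have h : MeasurableSpace.comap (ξ i) inferInstance ≤ finsetFiltration hm F hF n :=
    le_iSup₂_of_le (f := fun i (_ : i ∈ (F n : Set I)) => MeasurableSpace.comap (ξ i) inferInstance)
      i hi le_rfl
  exact (comap_measurable (ξ i)).mono h le_rfl

theorem integrable_conj_mul (h2 : ∀ i, MemLp (ξ i) 2 P) (i j : I) :
    Integrable (fun ω => star (ξ i ω) * ξ j ω) P :=
  (h2 i).star.integrable_mul (h2 j)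

theorem integral_conj_mul_eq_zero (hm : ∀ i, Measurable (ξ i)) (hind : iIndepFun ξ P)
    (h0 : ∀ i, ∫ ω, ξ i ω ∂P = 0) {i j : I} (hij : i ≠ j) :
    ∫ ω, star (ξ i ω) * ξ j ω ∂P = 0 := by
  have h1 : IndepFun (fun ω => star (ξ i ω)) (ξ j) P :=
    (hind.indepFun hij).comp (φ := star) (ψ := id) continuous_star.measurable measurable_id
  rw [h1.integral_fun_mul_eq_mul_integral (continuous_star.measurable.comp (hm i)).aestronglyMeasurable
    (hm j).aestronglyMeasurable, h0, mul_zero]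

/-- On an event of the past, $1_s\overline{\xi_i}$ depends only on the past, while $\xi_j$ is
centred and independent of it. New increments are thus orthogonal to old sums on every past event.
-/
theorem setIntegral_conj_mul_eq_zero (hm : ∀ i, Measurable (ξ i)) (hind : iIndepFun ξ P)
    (h0 : ∀ i, ∫ ω, ξ i ω ∂P = 0) (F : ℕ → Finset I) (hF : Monotone F) {n : ℕ} {i j : I}
    (hi : i ∈ F n) (hj : j ∉ F n) {s : Set Ω} (hs : MeasurableSet[finsetFiltration hm F hF n] s) :
    ∫ ω in s, star (ξ i ω) * ξ j ω ∂P = 0 := by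
  have hs' : MeasurableSet s := (finsetFiltration hm F hF).le n s hs
  let X : Ω → ℂ := s.indicator fun ω => star (ξ i ω)
  have hX : Measurable[finsetFiltration hm F hF n] X :=
    Measurable.indicator
      (continuous_star.measurable.comp (measurable_finsetFiltration hm F hF hi)) hs
  have h1 : Indep (finsetFiltration hm F hF n) (MeasurableSpace.comap (ξ j) inferInstance) P := by
    have := indep_iSup_of_disjoint (fun i => (hm i).comap_le) hind.iIndep
      (S := (F n : Set I)) (T := {j}) (by simpa using hj)
    rw [iSup_singleton] at this
    exact this
  have h2 : IndepFun X (ξ j) P :=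
    (IndepFun_iff_Indep _ _ _).2 (indep_of_indep_of_le_left h1 hX.comap_le)
  rw [← integral_indicator hs']
  have h3 : (s.indicator fun ω => star (ξ i ω) * ξ j ω) = fun ω => X ω * ξ j ω := by
    funext ω
    by_cases hω : ω ∈ s <;> simp [X, hω]
  rw [h3, h2.integral_fun_mul_eq_mul_integral
    (hX.mono ((finsetFiltration hm F hF).le n) le_rfl).aestronglyMeasurable
    (hm j).aestronglyMeasurable, h0, mul_zero]

theorem integrable_inner_sum_smul (h2 : ∀ i, MemLp (ξ i) 2 P) (y : I → K) (A B : Finset I) :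
    Integrable (fun ω => inner ℂ (∑ i ∈ A, ξ i ω • y i) (∑ j ∈ B, ξ j ω • y j)) P := by
  simp only [inner_sum_smul_sum_smul]
  exact integrable_finsetSum _ fun i _ => integrable_finsetSum _ fun j _ =>
    (integrable_conj_mul h2 i j).const_mul _

theorem integrable_norm_sq_sum_smul (h2 : ∀ i, MemLp (ξ i) 2 P) (y : I → K) (A : Finset I) :
    Integrable (fun ω => ‖∑ i ∈ A, ξ i ω • y i‖ ^ 2) P := by
  have := (integrable_inner_sum_smul h2 y A A).re
  refine this.congr (ae_of_all _ fun ω => ?_)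
  exact inner_self_eq_norm_sq _

/-- The second moment of a finite sum with independent centred coefficients. -/
theorem integral_norm_sq_sum_smul_le (hm : ∀ i, Measurable (ξ i)) (hind : iIndepFun ξ P)
    (h2 : ∀ i, MemLp (ξ i) 2 P) (h0 : ∀ i, ∫ ω, ξ i ω ∂P = 0) {V : ℝ}
    (hV : ∀ i, ∫ ω, ‖ξ i ω‖ ^ 2 ∂P ≤ V) (y : I → K) (A : Finset I) :
    ∫ ω, ‖∑ i ∈ A, ξ i ω • y i‖ ^ 2 ∂P ≤ V * ∑ i ∈ A, ‖y i‖ ^ 2 := by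
  have h1 : ((∫ ω, ‖∑ i ∈ A, ξ i ω • y i‖ ^ 2 ∂P : ℝ) : ℂ) =
      ∑ i ∈ A, ((‖y i‖ ^ 2 * ∫ ω, ‖ξ i ω‖ ^ 2 ∂P : ℝ) : ℂ) := by
    rw [← integral_complex_ofReal]
    have e1 : ∀ ω, ((‖∑ i ∈ A, ξ i ω • y i‖ ^ 2 : ℝ) : ℂ) =
        ∑ i ∈ A, ∑ j ∈ A, inner ℂ (y i) (y j) * (star (ξ i ω) * ξ j ω) := fun ω => by
      rw [← inner_sum_smul_sum_smul, inner_self_eq_norm_sq_to_K]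
      simp
    simp only [e1]
    rw [integral_finsetSum _ fun i _ => integrable_finsetSum _ fun j _ =>
      (integrable_conj_mul h2 i j).const_mul _]
    refine Finset.sum_congr rfl fun i hi => ?_
    rw [integral_finsetSum _ fun j _ => (integrable_conj_mul h2 i j).const_mul _,
      Finset.sum_eq_single i]
    · rw [integral_const_mul, inner_self_eq_norm_sq_to_K, Complex.ofReal_mul,
        ← integral_complex_ofReal]
      congr 1
      · simp
      · refine integral_congr_ae (ae_of_all _ fun ω => ?_)
        simp only [Complex.star_def]
        rw [mul_comm, Complex.mul_conj, Complex.normSq_eq_norm_sq]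
    · intro j _ hj
      rw [integral_const_mul, integral_conj_mul_eq_zero hm hind h0 hj.symm, mul_zero]
    · intro h; exact absurd hi h
  rw [← Complex.ofReal_sum, Complex.ofReal_inj] at h1
  rw [h1, Finset.mul_sum]
  refine Finset.sum_le_sum fun i _ => ?_
  rw [mul_comm]
  exact mul_le_mul_of_nonneg_right (hV i) (by positivity)

variable [IsProbabilityMeasure P]

/-- Expanding the square at the next time, the cross term integrates to zero over past events and
the squared increment is nonnegative. This is the input to Doob's maximal inequality. -/
theorem submartingale_norm_sq_sum_smul (hm : ∀ i, Measurable (ξ i)) (hind : iIndepFun ξ P)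
    (h2 : ∀ i, MemLp (ξ i) 2 P) (h0 : ∀ i, ∫ ω, ξ i ω ∂P = 0) (y : I → K) (F : ℕ → Finset I)
    (hF : Monotone F) :
    Submartingale (fun n ω => ‖∑ i ∈ F n, ξ i ω • y i‖ ^ 2) (finsetFiltration hm F hF) P := by
  classical
  refine submartingale_of_setIntegral_le_succ ?_ (fun n => integrable_norm_sq_sum_smul h2 y _) ?_
  · intro n
    refine StronglyMeasurable.pow (StronglyMeasurable.norm ?_) 2
    refine Finset.stronglyMeasurable_fun_sum _ fun i hi => ?_
    exact (measurable_finsetFiltration hm F hF hi).stronglyMeasurable.smul_const _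
  · intro n s hs
    have hs' : MeasurableSet s := (finsetFiltration hm F hF).le n s hs
    let D := F (n + 1) \ F n
    have hsplit : ∀ ω, ∑ i ∈ F (n + 1), ξ i ω • y i =
        (∑ i ∈ F n, ξ i ω • y i) + ∑ i ∈ D, ξ i ω • y i := fun ω => by
      rw [add_comm (∑ i ∈ F n, ξ i ω • y i)]
      exact (Finset.sum_sdiff (f := fun i => ξ i ω • y i) (hF (Nat.le_succ n))).symm
    have hint := integrable_inner_sum_smul h2 y (F n) D
    have hcross : ∫ ω in s, (inner ℂ (∑ i ∈ F n, ξ i ω • y i) (∑ j ∈ D, ξ j ω • y j)).re ∂P = 0 := by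
      have e1 := integral_re (𝕜 := ℂ) hint.integrableOn (μ := P.restrict s)
      have e2 : ∫ ω in s, inner ℂ (∑ i ∈ F n, ξ i ω • y i) (∑ j ∈ D, ξ j ω • y j) ∂P = 0 := by
        simp only [inner_sum_smul_sum_smul]
        rw [integral_finsetSum _ fun i _ => integrable_finsetSum _ fun j _ =>
          ((integrable_conj_mul h2 i j).const_mul _).integrableOn]
        refine Finset.sum_eq_zero fun i hi => ?_
        rw [integral_finsetSum _ fun j _ =>
          ((integrable_conj_mul h2 i j).const_mul _).integrableOn]
        refine Finset.sum_eq_zero fun j hj => ?_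
        rw [integral_const_mul, setIntegral_conj_mul_eq_zero hm hind h0 F hF hi
          (Finset.mem_sdiff.1 hj).2 hs, mul_zero]
      rw [e2] at e1
      simpa using e1
    have hre : Integrable (fun ω => 2 *
        (inner ℂ (∑ i ∈ F n, ξ i ω • y i) (∑ j ∈ D, ξ j ω • y j)).re) P :=
      hint.re.const_mul 2
    calc ∫ ω in s, ‖∑ i ∈ F n, ξ i ω • y i‖ ^ 2 ∂P
        = ∫ ω in s, (‖∑ i ∈ F n, ξ i ω • y i‖ ^ 2 + 2 *
          (inner ℂ (∑ i ∈ F n, ξ i ω • y i) (∑ j ∈ D, ξ j ω • y j)).re) ∂P := by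
          rw [integral_add (integrable_norm_sq_sum_smul h2 y _).integrableOn hre.integrableOn,
            integral_const_mul, hcross, mul_zero, add_zero]
      _ ≤ ∫ ω in s, ‖∑ i ∈ F (n + 1), ξ i ω • y i‖ ^ 2 ∂P := by
          refine setIntegral_mono
            ((integrable_norm_sq_sum_smul h2 y _).integrableOn.add hre.integrableOn)
            (integrable_norm_sq_sum_smul h2 y _).integrableOn fun ω => ?_
          simp only [hsplit]
          rw [norm_add_sq (𝕜 := ℂ)]
          have := sq_nonneg ‖∑ i ∈ D, ξ i ω • y i‖
          simp only [RCLike.re_to_complex]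
          linarith

/-- Kolmogorov's maximal inequality in a Hilbert space. -/
theorem measure_exists_le_norm_sq_sum_smul (hm : ∀ i, Measurable (ξ i)) (hind : iIndepFun ξ P)
    (h2 : ∀ i, MemLp (ξ i) 2 P) (h0 : ∀ i, ∫ ω, ξ i ω ∂P = 0) {V : ℝ}
    (hV : ∀ i, ∫ ω, ‖ξ i ω‖ ^ 2 ∂P ≤ V) (hV0 : 0 ≤ V) (y : I → K) (F : ℕ → Finset I)
    (hF : Monotone F) {c : ℝ} (hc : ∀ n, ∑ i ∈ F n, ‖y i‖ ^ 2 ≤ c) (ε : NNReal) :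
    ε * P {ω | ∃ n, (ε : ℝ) ≤ ‖∑ i ∈ F n, ξ i ω • y i‖ ^ 2} ≤ ENNReal.ofReal (V * c) := by
  have hsub := submartingale_norm_sq_sum_smul hm hind h2 h0 y F hF
  let E : ℕ → Set Ω := fun n => {ω | ∃ k ≤ n, (ε : ℝ) ≤ ‖∑ i ∈ F k, ξ i ω • y i‖ ^ 2}
  have hE : {ω | ∃ n, (ε : ℝ) ≤ ‖∑ i ∈ F n, ξ i ω • y i‖ ^ 2} = ⋃ n, E n := by
    ext ω
    simp only [Set.mem_ofPred_eq, Set.mem_iUnion, E]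
    exact ⟨fun ⟨n, hn⟩ => ⟨n, n, le_rfl, hn⟩, fun ⟨_, k, _, hk⟩ => ⟨k, hk⟩⟩
  have hmono : Monotone E := fun m n hmn ω ⟨k, hk, h⟩ => ⟨k, hk.trans hmn, h⟩
  rw [hE, hmono.measure_iUnion, ENNReal.mul_iSup]
  refine iSup_le fun n => ?_
  have h3 := maximal_ineq hsub (fun n ω => by positivity) (ε := ε) n
  have h4 : {ω | (ε : ℝ) ≤ (Finset.range (n + 1)).sup' Finset.nonempty_range_add_one
      fun k => ‖∑ i ∈ F k, ξ i ω • y i‖ ^ 2} = E n := by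
    ext ω
    simp only [Set.mem_ofPred_eq, E, Finset.le_sup'_iff, Finset.mem_range, Nat.lt_succ_iff]
  rw [h4] at h3
  refine h3.trans (ENNReal.ofReal_le_ofReal ?_)
  calc ∫ ω in E n, ‖∑ i ∈ F n, ξ i ω • y i‖ ^ 2 ∂P
      ≤ ∫ ω, ‖∑ i ∈ F n, ξ i ω • y i‖ ^ 2 ∂P :=
        setIntegral_le_integral (integrable_norm_sq_sum_smul h2 y _)
          (ae_of_all _ fun ω => by positivity)
    _ ≤ V * ∑ i ∈ F n, ‖y i‖ ^ 2 := integral_norm_sq_sum_smul_le hm hind h2 h0 hV y _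
    _ ≤ V * c := mul_le_mul_of_nonneg_left (hc n) hV0

/-- A series of square-summable vectors with independent centred coefficients of bounded variance
is almost surely Cauchy along every increasing exhaustion by finite sets. -/
theorem ae_cauchySeq_sum_smul (hm : ∀ i, Measurable (ξ i)) (hind : iIndepFun ξ P)
    (h2 : ∀ i, MemLp (ξ i) 2 P) (h0 : ∀ i, ∫ ω, ξ i ω ∂P = 0) {V : ℝ}
    (hV : ∀ i, ∫ ω, ‖ξ i ω‖ ^ 2 ∂P ≤ V) (hV0 : 0 ≤ V) {y : I → K}
    (hy : Summable fun i => ‖y i‖ ^ 2) {F : ℕ → Finset I} (hF : Monotone F)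
    (hF' : Tendsto F atTop atTop) :
    ∀ᵐ ω ∂P, CauchySeq fun n => ∑ i ∈ F n, ξ i ω • y i := by
  classical
  -- `bad ε m`: some later partial sum differs from the `m`-th by at least $\sqrt\varepsilon$. The
  -- maximal inequality bounds its probability by $V\,\mathrm{tail}(m)/\varepsilon\to0$; thresholds
  -- $1/(j+1)$ keep the exceptional set a countable union.
  let bad : NNReal → ℕ → Set Ω := fun ε m =>
    {ω | ∃ n, (ε : ℝ) ≤ ‖∑ i ∈ F (m + n) \ F m, ξ i ω • y i‖ ^ 2}
  let tail : ℕ → ℝ := fun m => (∑' i, ‖y i‖ ^ 2) - ∑ i ∈ F m, ‖y i‖ ^ 2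
  have htail : Tendsto (fun m => ENNReal.ofReal (V * tail m)) atTop (𝓝 0) := by
    have h1 : Tendsto tail atTop (𝓝 0) := by
      have := (hy.hasSum.comp hF').const_sub (∑' i, ‖y i‖ ^ 2)
      rw [sub_self] at this
      exact this
    have h3 := ENNReal.tendsto_ofReal (h1.const_mul V)
    simpa using h3
  have hbad : ∀ (ε : NNReal) m, ε * P (bad ε m) ≤ ENNReal.ofReal (V * tail m) := by
    intro ε m
    refine measure_exists_le_norm_sq_sum_smul hm hind h2 h0 hV hV0 y
      (fun n => F (m + n) \ F m) (fun a b hab => Finset.sdiff_subset_sdiff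
        (hF (Nat.add_le_add_left hab m)) le_rfl) (fun n => ?_) ε
    rw [le_sub_iff_add_le, Finset.sum_sdiff (hF (Nat.le_add_right m n))]
    exact hy.sum_le_tsum _ fun i _ => by positivity
  have hnull : ∀ j : ℕ, P (⋂ m, bad (1 / (j + 1)) m) = 0 := by
    intro j
    set ε : NNReal := 1 / (j + 1) with hε
    have hε0 : (ε : ENNReal) ≠ 0 := by
      rw [Ne, ENNReal.coe_eq_zero, hε]; positivity
    have h3 : ε * P (⋂ m, bad ε m) ≤ 0 :=
      ge_of_tendsto' htail fun m =>
        (mul_le_mul_right (measure_mono (Set.iInter_subset _ m)) _).trans (hbad ε m)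
    have h4 := le_antisymm h3 zero_le
    exact (mul_eq_zero.1 h4).resolve_left hε0
  have hall : ∀ᵐ ω ∂P, ∀ j : ℕ, ω ∉ ⋂ m, bad (1 / (j + 1)) m :=
    ae_all_iff.2 fun j => measure_eq_zero_iff_ae_notMem.1 (hnull j)
  filter_upwards [hall] with ω hω
  rw [Metric.cauchySeq_iff']
  intro δ hδ
  obtain ⟨j, hj⟩ := exists_nat_one_div_lt (show 0 < δ ^ 2 by positivity)
  obtain ⟨m, hmm⟩ := by simpa only [Set.mem_iInter, not_forall] using hω j
  refine ⟨m, fun n hn => ?_⟩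
  obtain ⟨k, rfl⟩ := Nat.exists_eq_add_of_le hn
  simp only [bad, Set.mem_ofPred_eq, not_exists, not_le] at hmm
  have h3 := hmm k
  rw [dist_eq_norm, ← Finset.sum_sdiff (hF (Nat.le_add_right m k)), add_sub_cancel_right]
  push_cast at h3
  exact lt_of_pow_lt_pow_left₀ 2 hδ.le (h3.trans hj)

end RandomSeries

/-! ### Hilbert–Schmidt operators and convergence of the truncations -/

section HilbertSchmidt

theorem lp_norm_sq_eq_tsum {H : Type*} [NormedAddCommGroup H]
    (f : lp (fun _ : ℕ => H) 2) : ‖f‖ ^ 2 = ∑' i, ‖f i‖ ^ 2 := by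
  have := lp.norm_rpow_eq_tsum (p := 2) (by simp) f
  simpa using this

variable {H : Type*} [NormedAddCommGroup H] [InnerProductSpace ℂ H]

theorem hasSum_norm_inner_sq {ι : Type*} (b : HilbertBasis ι ℂ H) (x : H) :
    HasSum (fun i => ‖inner ℂ (b i) x‖ ^ 2) (‖x‖ ^ 2) := by
  have h := b.hasSum_inner_mul_inner x x
  have h2 := Complex.hasSum_re h
  convert h2 using 1
  · funext i
    rw [← inner_conj_symm x (b i), RCLike.conj_mul]
    norm_cast
  · rw [inner_self_eq_norm_sq_to_K]
    norm_cast

/-- The coordinates of a rank-one operator, as a vector in a Hilbert space whose norm is the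
Hilbert–Schmidt norm. -/
def rankOneVector (e : HilbertBasis ℕ ℂ H) (u v : H) : lp (fun _ : ℕ => H) 2 :=
  ⟨fun i => inner ℂ v (e i) • u, by
    refine memℓp_gen ?_
    simp only [ENNReal.toReal_ofNat, Real.rpow_ofNat, norm_smul, mul_pow]
    refine Summable.mul_right _ ?_
    refine (hasSum_norm_inner_sq e v).summable.congr fun i => ?_
    rw [← inner_conj_symm v (e i), RCLike.norm_conj]⟩

theorem norm_rankOneVector_sq (e : HilbertBasis ℕ ℂ H) (u v : H) :
    ‖rankOneVector e u v‖ ^ 2 = ‖u‖ ^ 2 * ‖v‖ ^ 2 := by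
  rw [lp_norm_sq_eq_tsum, ← (hasSum_norm_inner_sq e v).tsum_eq, ← tsum_mul_left]
  refine tsum_congr fun i => ?_
  change ‖inner ℂ v (e i) • u‖ ^ 2 = _
  rw [norm_smul, mul_pow, ← inner_conj_symm v (e i), RCLike.norm_conj, mul_comm]

variable [CompleteSpace H]

/-- Square summability over one Hilbert basis passes to the adjoint and any other Hilbert basis. -/
theorem summable_norm_adjoint_sq {ι κ : Type*} (b : HilbertBasis ι ℂ H) (c : HilbertBasis κ ℂ H)
    (S : H →L[ℂ] H) (hS : Summable fun i => ‖S (b i)‖ ^ 2) :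
    Summable fun k => ‖ContinuousLinearMap.adjoint S (c k)‖ ^ 2 := by
  -- The double series $\sum|\langle Sb_i,c_k\rangle|^2$ is summed in both orders, by Parseval each
  -- time.
  let f : ι × κ → ℝ := fun p => ‖inner ℂ (c p.2) (S (b p.1))‖ ^ 2
  have hf : 0 ≤ f := fun p => sq_nonneg _
  have h1 : Summable f := by
    have e1 : ∀ i, HasSum (fun k => f (i, k)) (‖S (b i)‖ ^ 2) := fun i =>
      hasSum_norm_inner_sq c (S (b i))
    refine (summable_prod_of_nonneg hf).2 ⟨fun i => (e1 i).summable, ?_⟩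
    exact hS.congr fun i => (e1 i).tsum_eq.symm
  have h2 : Summable (f ∘ Prod.swap) := h1.comp_injective Prod.swap_injective
  have h3 := ((summable_prod_of_nonneg (f := f ∘ Prod.swap) (fun p => hf p.swap)).1 h2).2
  refine h3.congr fun k => ?_
  rw [← (hasSum_norm_inner_sq b (ContinuousLinearMap.adjoint S (c k))).tsum_eq]
  refine tsum_congr fun i => ?_
  simp only [f, Function.comp_apply, Prod.swap_prod_mk]
  rw [ContinuousLinearMap.adjoint_inner_right, ← inner_conj_symm (S (b i)) (c k), RCLike.norm_conj]

theorem IsHilbertSchmidt.summable_norm_adjoint_sq {S : H →L[ℂ] H} (hS : IsHilbertSchmidt S)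
    {κ : Type*} (c : HilbertBasis κ ℂ H) :
    Summable fun k => ‖ContinuousLinearMap.adjoint S (c k)‖ ^ 2 :=
  RandomPerturbation.summable_norm_adjoint_sq (onb H) c S hS

theorem IsHilbertSchmidt.summable_norm_sq {S : H →L[ℂ] H} (hS : IsHilbertSchmidt S)
    {κ : Type*} (c : HilbertBasis κ ℂ H) : Summable fun k => ‖S (c k)‖ ^ 2 := by
  have := RandomPerturbation.summable_norm_adjoint_sq c c _ (hS.summable_norm_adjoint_sq c)
  rwa [ContinuousLinearMap.adjoint_adjoint] at this

/-- The operator norm is at most the Hilbert–Schmidt norm. -/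
theorem norm_le_norm_lp (e : HilbertBasis ℕ ℂ H) (T : H →L[ℂ] H) (f : lp (fun _ : ℕ => H) 2)
    (hf : ∀ i, T (e i) = f i) : ‖T‖ ≤ ‖f‖ := by
  -- For the adjoint, Parseval gives $\|T^*x\|^2=\sum_i|\langle Te_i,x\rangle|^2$, and
  -- Cauchy–Schwarz applies termwise.
  rw [← LinearIsometryEquiv.norm_map ContinuousLinearMap.adjoint T]
  refine ContinuousLinearMap.opNorm_le_bound _ (norm_nonneg _) fun x => ?_
  refine le_of_sq_le_sq ?_ (by positivity)
  have hs : Summable fun i => ‖f i‖ ^ 2 := by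
    have := (lp.memℓp f).summable (by simp)
    simpa using this
  rw [← (hasSum_norm_inner_sq e _).tsum_eq, mul_pow, lp_norm_sq_eq_tsum, ← tsum_mul_right]
  refine (hasSum_norm_inner_sq e _).summable.tsum_le_tsum (fun i => ?_) (hs.mul_right _)
  rw [ContinuousLinearMap.adjoint_inner_right, hf, ← mul_pow]
  gcongr
  exact norm_inner_le_norm _ _

/-- This form shows the Hilbert–Schmidt norm $\|S_1e^1_j\|\,\|S_2^*e^2_k\|$ of each term of the
series, which is square summable over pairs. -/
theorem comp_rankOne_comp_eq (S₁ S₂ : H →L[ℂ] H) (u v : H) :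
    S₁ ∘L InnerProductSpace.rankOne ℂ u v ∘L S₂ =
      InnerProductSpace.rankOne ℂ (S₁ u) (ContinuousLinearMap.adjoint S₂ v) := by
  ext x
  simp [ContinuousLinearMap.adjoint_inner_left]

/-- Norms of sums of rank-one operators are controlled by the Hilbert–Schmidt norm. -/
theorem norm_sum_smul_rankOne_le {I : Type*} (e : HilbertBasis ℕ ℂ H) (A : Finset I) (x : I → ℂ)
    (u v : I → H) : ‖∑ i ∈ A, x i • InnerProductSpace.rankOne ℂ (u i) (v i)‖ ≤
      ‖∑ i ∈ A, x i • rankOneVector e (u i) (v i)‖ := by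
  refine norm_le_norm_lp e _ _ fun j => ?_
  rw [lp.coeFn_sum, Finset.sum_apply, sum_apply]
  refine Finset.sum_congr rfl fun i _ => ?_
  rfl

/-- The index sets of the square truncations. -/
def square (n : ℕ) : Finset (ℕ × ℕ) := Finset.range n ×ˢ Finset.range n

theorem monotone_square : Monotone square := fun _ _ h =>
  Finset.product_subset_product (Finset.range_mono h) (Finset.range_mono h)

theorem tendsto_square : Tendsto square atTop atTop := by
  refine tendsto_atTop_finset_of_monotone monotone_square fun p => ⟨p.1 + p.2 + 1, ?_⟩
  simp only [square, Finset.mem_product, Finset.mem_range]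
  omega

variable {Ω : Type*} [MeasurableSpace Ω] {P : Measure Ω} [IsProbabilityMeasure P]

/-- The truncations converge almost surely in operator norm. -/
theorem ae_cauchySeq_truncation {ξ : ℕ × ℕ → Ω → ℂ} (hm : ∀ i, Measurable (ξ i))
    (hind : iIndepFun ξ P) (hlaw : ∀ i, HasLaw (ξ i) stdComplexGaussian P)
    (e₁ e₂ : HilbertBasis ℕ ℂ H) {S₁ S₂ : H →L[ℂ] H}
    (hS₁ : IsHilbertSchmidt S₁) (hS₂ : IsHilbertSchmidt S₂) :
    ∀ᵐ ω ∂P, CauchySeq (truncation e₁ e₂ S₁ S₂ fun j k => ξ (j, k) ω) := by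
  have hint : ∀ i, Integrable (fun ω => ‖ξ i ω‖ ^ 2) P := fun i => by
    have := integrable_norm_sq_stdComplexGaussian
    rw [← (hlaw i).map_eq] at this
    exact this.comp_measurable (hm i)
  have h2 : ∀ i, MemLp (ξ i) 2 P := fun i =>
    (memLp_two_iff_integrable_sq_norm (hm i).aestronglyMeasurable).2 (hint i)
  have h0 : ∀ i, ∫ ω, ξ i ω ∂P = 0 := fun i => by
    have := integral_map (μ := P) (hm i).aemeasurable (f := fun z : ℂ => z)
      (by fun_prop)
    rw [← this, (hlaw i).map_eq, integral_id_stdComplexGaussian]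
  have hV : ∀ i, ∫ ω, ‖ξ i ω‖ ^ 2 ∂P ≤ ∫ z, ‖z‖ ^ 2 ∂stdComplexGaussian := fun i => by
    have := integral_map (μ := P) (hm i).aemeasurable (f := fun z : ℂ => ‖z‖ ^ 2)
      (by fun_prop)
    rw [← this, (hlaw i).map_eq]
  let u : ℕ × ℕ → H := fun p => S₁ (e₁ p.1)
  let v : ℕ × ℕ → H := fun p => ContinuousLinearMap.adjoint S₂ (e₂ p.2)
  have hy : Summable fun p => ‖rankOneVector e₁ (u p) (v p)‖ ^ 2 := by
    have h3 := (hS₁.summable_norm_sq e₁).mul_of_nonneg (hS₂.summable_norm_adjoint_sq e₂)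
      (fun j => sq_nonneg ‖S₁ (e₁ j)‖)
      (fun k => sq_nonneg ‖ContinuousLinearMap.adjoint S₂ (e₂ k)‖)
    exact h3.congr fun p => (norm_rankOneVector_sq e₁ (u p) (v p)).symm
  have hc := ae_cauchySeq_sum_smul hm hind h2 h0 hV (integral_nonneg fun _ => by positivity) hy
    monotone_square tendsto_square
  filter_upwards [hc] with ω hω
  have htr : ∀ n, truncation e₁ e₂ S₁ S₂ (fun j k => ξ (j, k) ω) n =
      ∑ p ∈ square n, ξ p ω • InnerProductSpace.rankOne ℂ (u p) (v p) := fun n => by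
    rw [truncation_eq_sum]
    simp only [comp_rankOne_comp_eq]
    rfl
  rw [Metric.cauchySeq_iff'] at hω ⊢
  intro δ hδ
  obtain ⟨m, hmm⟩ := hω δ hδ
  refine ⟨m, fun n hn => lt_of_le_of_lt ?_ (hmm n hn)⟩
  rw [dist_eq_norm, dist_eq_norm, htr, htr, ← Finset.sum_sdiff (monotone_square hn),
    ← Finset.sum_sdiff (f := fun p => ξ p ω • rankOneVector e₁ (u p) (v p)) (monotone_square hn),
    add_sub_cancel_right, add_sub_cancel_right]
  exact norm_sum_smul_rankOne_le e₁ _ _ _ _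

end HilbertSchmidt

/-! ### From finitely many coefficients to the full series -/

section Conditioning

theorem measurable_biSup_comap {Ω I : Type*} {ξ : I → Ω → ℂ} {S : Set I} {i : I} (hi : i ∈ S) :
    Measurable[⨆ i ∈ S, MeasurableSpace.comap (ξ i) inferInstance] (ξ i) := by
  have h : MeasurableSpace.comap (ξ i) inferInstance ≤
      ⨆ i ∈ S, MeasurableSpace.comap (ξ i) inferInstance :=
    le_iSup₂_of_le (f := fun i (_ : i ∈ S) => MeasurableSpace.comap (ξ i) inferInstance)
      i hi le_rfl
  exact (comap_measurable (ξ i)).mono h le_rfl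

variable {Ω : Type*} [MeasurableSpace Ω] {P : Measure Ω}

/-- Only norms of differences enter, so `E` may be nonseparable, as the space of bounded operators
is. -/
theorem measurableSet_setOf_cauchySeq {E : Type*} [NormedAddCommGroup E]
    {f : ℕ → Ω → E} (hf : ∀ n, StronglyMeasurable (f n)) :
    MeasurableSet {ω | CauchySeq fun n => f n ω} := by
  have : {ω | CauchySeq fun n => f n ω} =
      ⋂ j : ℕ, ⋃ m : ℕ, ⋂ k : ℕ, {ω | ‖f (m + k) ω - f m ω‖ < 1 / ((j : ℝ) + 1)} := by
    ext ω
    simp only [Set.mem_ofPred_eq, Set.mem_iInter, Set.mem_iUnion]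
    rw [Metric.cauchySeq_iff']
    constructor
    · intro h j
      obtain ⟨m, hm⟩ := h (1 / ((j : ℝ) + 1)) (by positivity)
      exact ⟨m, fun k => by
        have := hm (m + k) (Nat.le_add_right m k)
        rwa [dist_eq_norm] at this⟩
    · intro h δ hδ
      obtain ⟨j, hj⟩ := exists_nat_one_div_lt hδ
      obtain ⟨m, hm⟩ := h j
      refine ⟨m, fun n hn => ?_⟩
      obtain ⟨k, rfl⟩ := Nat.exists_eq_add_of_le hn
      rw [dist_eq_norm]
      exact (hm k).trans hj
  rw [this]
  refine MeasurableSet.iInter fun j => MeasurableSet.iUnion fun m => MeasurableSet.iInter fun k => ?_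
  exact measurableSet_lt ((hf _).sub (hf _)).norm.measurable measurable_const

variable [IsProbabilityMeasure P]

/-- A limit of random series with independent coefficients of law `γ` avoids the complement of an
open set `U` almost surely, provided that finite partial sums of the series can hit `U` and that
changing finitely many coefficients leaves `U` only on a null set once `U` can be hit. -/
theorem ae_mem_of_tendsto_sum_smul {I : Type*} {ξ : I → Ω → ℂ} {γ : Measure ℂ}
    (hm : ∀ i, Measurable (ξ i)) (hind : iIndepFun ξ P) (hlaw : ∀ i, P.map (ξ i) = γ)
    {E : Type*} [NormedAddCommGroup E] [NormedSpace ℂ E] [CompleteSpace E] (Y : I → E)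
    {F : ℕ → Finset I} (hF : Monotone F) {Q : Ω → E}
    (hQ : ∀ᵐ ω ∂P, Tendsto (fun n => ∑ i ∈ F n, ξ i ω • Y i) atTop (𝓝 (Q ω)))
    {U : Set E} (hU : IsOpen U)
    (hnull : ∀ (A : Finset I) (C : E) (a : A → ℂ), C + ∑ i, a i • Y i ∈ U →
      Measure.pi (fun _ : A => γ) {x | C + ∑ i, x i • Y i ∉ U} = 0)
    {m₀ : ℕ} {a₀ : I → ℂ} (ha₀ : ∑ i ∈ F m₀, a₀ i • Y i ∈ U) :
    ∀ᵐ ω ∂P, Q ω ∈ U := by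
  classical
  obtain ⟨ε, hε, hball⟩ := Metric.isOpen_iff.1 hU _ ha₀
  -- It suffices to treat each `N` separately: almost surely the tail beyond some $N\ge m_0$ is
  -- smaller than `ε`.
  have key : ∀ N ≥ m₀, ∀ᵐ ω ∂P, ¬ (‖Q ω - ∑ i ∈ F N, ξ i ω • Y i‖ < ε ∧ Q ω ∉ U) := by
    intro N hN
    let A := F N
    let X : Ω → A → ℂ := fun ω i => ξ i ω
    let B : Ω → I → ℂ := fun ω i => if i ∈ A then 0 else ξ i ω
    have hX : Measurable X := measurable_pi_lambda _ fun i => hm i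
    have hB : Measurable B := measurable_pi_lambda _ fun i => by
      by_cases hi : i ∈ A
      · simp [B, hi]
      · simpa [B, hi] using hm i
    have hBX : IndepFun B X P := by
      have h1 := indep_iSup_of_disjoint (fun i => (hm i).comap_le) hind.iIndep
        (S := (A : Set I)ᶜ) (T := A) disjoint_compl_left
      refine (IndepFun_iff_Indep _ _ _).2 (indep_of_indep_of_le_left
        (indep_of_indep_of_le_right h1 ?_) ?_)
      · refine Measurable.comap_le (@measurable_pi_lambda _ _ _ (_) _ _ fun i => ?_)
        exact measurable_biSup_comap (S := (A : Set I)) i.2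
      · refine Measurable.comap_le (@measurable_pi_lambda _ _ _ (_) _ _ fun i => ?_)
        by_cases hi : i ∈ A
        · simp only [B, hi, if_true]
          exact measurable_const
        · simp only [B, hi, if_false]
          exact measurable_biSup_comap (S := (A : Set I)ᶜ) (by simpa using hi)
    have hprod := (indepFun_iff_map_prod_eq_prod_map_map hB.aemeasurable hX.aemeasurable).1 hBX
    have hlawX : P.map X = Measure.pi fun _ : A => γ := by
      have h1 : iIndepFun (fun i : A => ξ i) P := hind.precomp Subtype.val_injective
      have h2 := (iIndepFun_iff_map_fun_eq_pi_map (f := fun i : A => ξ i)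
        fun i => (hm i).aemeasurable).1 h1
      simpa only [hlaw] using h2
    have : IsProbabilityMeasure (P.map X) := Measure.isProbabilityMeasure_map hX.aemeasurable
    have : IsProbabilityMeasure (P.map B) := Measure.isProbabilityMeasure_map hB.aemeasurable
    let c : (I → ℂ) × (A → ℂ) → I → ℂ := fun p i => if h : i ∈ A then p.2 ⟨i, h⟩ else p.1 i
    have hcm : ∀ i, Measurable fun p => c p i := fun i => by
      by_cases hi : i ∈ A
      · simp only [c, hi, dif_pos]; fun_prop
      · simp only [c, hi, dif_neg, not_false_eq_true]; fun_prop
    let f : ℕ → (I → ℂ) × (A → ℂ) → E := fun n p => ∑ i ∈ F n, c p i • Y i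
    have hf : ∀ n, StronglyMeasurable (f n) := fun n =>
      Finset.stronglyMeasurable_fun_sum _ fun i _ =>
        (hcm i).stronglyMeasurable.smul_const _
    have hcX : ∀ ω, c (B ω, X ω) = fun i => ξ i ω := fun ω => by
      funext i
      by_cases hi : i ∈ A <;> simp [c, B, X, hi]
    have hBXm : Measurable fun ω => (B ω, X ω) := hB.prodMk hX
    have hcau : ∀ᵐ p ∂(P.map B).prod (P.map X), CauchySeq fun n => f n p := by
      rw [← hprod, ae_map_iff hBXm.aemeasurable (measurableSet_setOf_cauchySeq hf)]
      filter_upwards [hQ] with ω hω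
      simp only [f, hcX]
      exact hω.cauchySeq
    -- `Q` carries no measurability; `Q'` is the limit as a measurable function of outer and inner
    -- coefficients, to which Fubini applies.
    obtain ⟨Q', hQ'm, hQ'⟩ := exists_stronglyMeasurable_limit_of_tendsto_ae
      (μ := (P.map B).prod (P.map X)) (f := f) (fun n => (hf n).aestronglyMeasurable)
      (hcau.mono fun p hp => cauchySeq_tendsto_of_complete hp)
    let t : (A → ℂ) → E := fun x => ∑ i : A, x i • Y i
    have ht : Continuous t := by fun_prop
    have htX : ∀ ω, t (X ω) = ∑ i ∈ A, ξ i ω • Y i := fun ω =>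
      Finset.sum_coe_sort A fun i => ξ i ω • Y i
    have htm : StronglyMeasurable fun p : (I → ℂ) × (A → ℂ) => t p.2 :=
      Finset.stronglyMeasurable_fun_sum _ fun i _ =>
        (Measurable.stronglyMeasurable (by fun_prop)).smul_const _
    let Z : Set ((I → ℂ) × (A → ℂ)) := {p | ‖Q' p - t p.2‖ < ε ∧ Q' p ∉ U}
    have hZ : MeasurableSet Z := by
      refine MeasurableSet.inter
        (measurableSet_lt (hQ'm.sub htm).norm.measurable measurable_const) ?_
      borelize E
      exact (hQ'm.measurable hU.measurableSet).compl
    have hZ0 : (P.map B).prod (P.map X) Z = 0 := by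
      rw [Measure.measure_prod_null hZ]
      filter_upwards [Measure.ae_ae_of_ae_prod hQ'] with b hb
      obtain ⟨x₀, hx₀⟩ := hb.exists
      have hr : ∀ x n, N ≤ n → f n (b, x) - t x = ∑ i ∈ F n \ A, b i • Y i := fun x n hn => by
        have h1 : t x = ∑ i ∈ A, c (b, x) i • Y i := by
          rw [← Finset.sum_coe_sort]
          refine Finset.sum_congr rfl fun i _ => ?_
          simp [c]
        rw [h1]
        simp only [f]
        rw [← Finset.sum_sdiff (hF hn), add_sub_cancel_right]
        refine Finset.sum_congr rfl fun i hi => ?_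
        simp [c, (Finset.mem_sdiff.1 hi).2]
      -- `R` is the sum of the outer terms. It depends on `b` alone, because the partial sums beyond
      -- `N` minus `t x` do not involve `x`.
      let R := Q' (b, x₀) - t x₀
      have hR : ∀ x, Tendsto (fun n => f n (b, x)) atTop (𝓝 (Q' (b, x))) →
          Q' (b, x) = R + t x := fun x hx => by
        have h1 : Tendsto (fun n => f n (b, x) - t x) atTop (𝓝 R) := by
          refine (hx₀.sub_const (t x₀)).congr' ?_
          filter_upwards [eventually_ge_atTop N] with n hn
          rw [hr x n hn, hr x₀ n hn]
        have h2 := tendsto_nhds_unique h1 (hx.sub_const (t x))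
        rw [h2, sub_add_cancel]
      by_cases hRε : ‖R‖ < ε
      -- A tail shorter than `ε` leaves the good point, extended by zero from `F m₀` to `A`, inside
      -- `U`; `hnull` then applies to this fibre.
      · have h1 : R + ∑ i : A, (if (i : I) ∈ F m₀ then a₀ i else 0) • Y i ∈ U := by
          have h2 : ∑ i : A, (if (i : I) ∈ F m₀ then a₀ i else 0) • Y i =
              ∑ i ∈ F m₀, a₀ i • Y i := by
            rw [Finset.sum_coe_sort A fun i => (if i ∈ F m₀ then a₀ i else 0) • Y i]
            simp only [ite_smul, zero_smul]
            rw [← Finset.sum_filter]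
            congr 1
            ext i
            simp only [Finset.mem_filter]
            exact ⟨fun h => h.2, fun h => ⟨hF hN h, h⟩⟩
          rw [h2]
          refine hball ?_
          rw [Metric.mem_ball, dist_eq_norm, add_sub_cancel_right]
          exact hRε
        have h3 := hnull A R _ h1
        rw [← hlawX] at h3
        have h4 : ∀ᵐ x ∂P.map X, x ∉ Prod.mk b ⁻¹' Z := by
          filter_upwards [hb, measure_eq_zero_iff_ae_notMem.1 h3] with x hx hx'
          simp only [not_not] at hx'
          intro hxZ
          refine hxZ.2 ?_
          rw [hR x hx]
          exact hx'
        exact measure_eq_zero_iff_ae_notMem.2 h4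
      · have h4 : ∀ᵐ x ∂P.map X, x ∉ Prod.mk b ⁻¹' Z := by
          filter_upwards [hb] with x hx hxZ
          have := hxZ.1
          rw [hR x hx] at this
          simp only [add_sub_cancel_right] at this
          exact hRε this
        exact measure_eq_zero_iff_ae_notMem.2 h4
    have hZ1 : ∀ᵐ ω ∂P, (B ω, X ω) ∉ Z := by
      rw [← hprod] at hZ0
      exact ae_of_ae_map hBXm.aemeasurable (measure_eq_zero_iff_ae_notMem.1 hZ0)
    have hQ'' : ∀ᵐ ω ∂P, Tendsto (fun n => f n (B ω, X ω)) atTop (𝓝 (Q' (B ω, X ω))) := by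
      rw [← hprod] at hQ'
      exact ae_of_ae_map hBXm.aemeasurable hQ'
    filter_upwards [hQ, hQ'', hZ1] with ω h1 h2 h3
    simp only [f, hcX] at h2
    rw [tendsto_nhds_unique h1 h2, ← htX]
    exact h3
  have hall : ∀ᵐ ω ∂P, ∀ N, N ≥ m₀ →
      ¬ (‖Q ω - ∑ i ∈ F N, ξ i ω • Y i‖ < ε ∧ Q ω ∉ U) :=
    ae_all_iff.2 fun N => by
      by_cases hN : N ≥ m₀
      · filter_upwards [key N hN] with ω hω _ using hω
      · exact ae_of_all _ fun ω h => absurd h hN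
  filter_upwards [hQ, hall] with ω h1 h2
  have h3 := (h1.eventually (Metric.ball_mem_nhds _ hε)).and (eventually_ge_atTop m₀)
  obtain ⟨N, hN1, hN2⟩ := h3.exists
  by_contra hcon
  refine h2 N hN2 ⟨?_, hcon⟩
  rw [dist_eq_norm] at hN1
  rwa [norm_sub_rev]

end Conditioning

/-! ### Almost sure invertibility at a Fredholm point -/

section AlmostSure

variable {H : Type*} [NormedAddCommGroup H] [InnerProductSpace ℂ H] [CompleteSpace H]
  {Ω : Type*} [MeasurableSpace Ω] {P : Measure Ω}

/-- Independent variables with a common law agree almost surely with everywhere measurable ones. -/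
theorem exists_measurable_version {I : Type*} [Countable I] {ξ : I → Ω → ℂ} {γ : Measure ℂ}
    (hlaw : ∀ i, HasLaw (ξ i) γ P) (hind : iIndepFun ξ P) :
    ∃ η : I → Ω → ℂ, (∀ i, Measurable (η i)) ∧ (∀ i, HasLaw (η i) γ P) ∧ iIndepFun η P ∧
      ∀ᵐ ω ∂P, ∀ i, ξ i ω = η i ω := by
  refine ⟨fun i => (hlaw i).aemeasurable.mk, fun i => (hlaw i).aemeasurable.measurable_mk,
    fun i => (hlaw i).congr (hlaw i).aemeasurable.ae_eq_mk.symm,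
    hind.congr fun i => (hlaw i).aemeasurable.ae_eq_mk, ae_all_iff.2 fun i =>
      (hlaw i).aemeasurable.ae_eq_mk⟩

variable [IsProbabilityMeasure P]

/-- `perturbation` is a `limUnder`, meaningful only where the limit exists; completeness supplies
the limit on the almost sure Cauchy event. A law gives only almost everywhere measurability, hence
the measurable version. -/
theorem ae_tendsto_truncation {ξ : ℕ × ℕ → Ω → ℂ}
    (hlaw : ∀ i, HasLaw (ξ i) stdComplexGaussian P) (hind : iIndepFun ξ P)
    (e₁ e₂ : HilbertBasis ℕ ℂ H) {S₁ S₂ : H →L[ℂ] H}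
    (hS₁ : IsHilbertSchmidt S₁) (hS₂ : IsHilbertSchmidt S₂) :
    ∀ᵐ ω ∂P, Tendsto (truncation e₁ e₂ S₁ S₂ fun j k => ξ (j, k) ω) atTop
      (𝓝 (perturbation e₁ e₂ S₁ S₂ fun j k => ξ (j, k) ω)) := by
  obtain ⟨η, hηm, hηl, hηi, hη⟩ := exists_measurable_version hlaw hind
  filter_upwards [hη, ae_cauchySeq_truncation hηm hηi hηl e₁ e₂ hS₁ hS₂] with ω h1 h2
  simp only [← h1] at h2
  exact tendsto_nhds_limUnder (cauchySeq_tendsto_of_complete h2)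

/-- An index-zero Fredholm point of `A` at which the perturbation acts injectively on kernel and
cokernel almost surely does not belong to the spectrum of the perturbed operator. -/
theorem ae_notMem_spec {A : H →ₗ.[ℂ] H} {z : ℂ} (hz : z ∈ fredholmDomainZero A)
    {S₁ S₂ : H →L[ℂ] H} (hS₁ : IsHilbertSchmidt S₁) (hS₂ : IsHilbertSchmidt S₂)
    (h₁ : ∀ c ∈ (LinearMap.range (shift A z).toFun)ᗮ,
      ContinuousLinearMap.adjoint S₁ c = 0 → c = 0)
    (h₂ : ∀ k ∈ kernel (shift A z), S₂ k = 0 → k = 0)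
    (e₁ e₂ : HilbertBasis ℕ ℂ H) {ξ : ℕ × ℕ → Ω → ℂ}
    (hlaw : ∀ i, HasLaw (ξ i) stdComplexGaussian P) (hind : iIndepFun ξ P) {δ : ℂ} (hδ : δ ≠ 0) :
    ∀ᵐ ω ∂P, z ∉ spec (addBounded A
      (δ • perturbation e₁ e₂ S₁ S₂ fun j k => ξ (j, k) ω)) := by
  obtain ⟨Φ, G, hΦ, hG⟩ := exists_isFiniteRank_hasInverse hz.1 hz.2
  obtain ⟨n, a, R, hR⟩ := exists_truncation_hasInverse hz.1 hz.2 e₁ e₂ S₁ S₂ h₁ h₂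
  obtain ⟨η, hηm, hηl, hηi, hη⟩ := exists_measurable_version hlaw hind
  have : IsProbabilityMeasure stdComplexGaussian := by
    rw [← (hlaw (0, 0)).map_eq]
    exact Measure.isProbabilityMeasure_map (hlaw (0, 0)).aemeasurable
  -- `U` consists of the `K` for which $A-z+\delta K$ is invertible; in this form it is visibly
  -- open.
  let U : Set (H →L[ℂ] H) := {K | IsUnit (1 + (δ • K - Φ) * G)}
  have hU : IsOpen U := Units.isOpen.preimage (by fun_prop)
  have hinv : ∀ K, (∃ R, HasInverse (addBounded (shift A z) K) R) ↔
      IsUnit (1 + (K - Φ) * G) := fun K => by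
    rw [← hG.exists_iff, addBounded_addBounded, add_sub_cancel]
  let Y : ℕ × ℕ → H →L[ℂ] H := fun p => S₁ ∘L InnerProductSpace.rankOne ℂ (e₁ p.1) (e₂ p.2) ∘L S₂
  have hY : ∀ p, IsFiniteRank (Y p) := fun p => isFiniteRank_comp_rankOne_comp _ _ _ _
  have ha : ∑ p ∈ square n, (δ⁻¹ * a p.1 p.2) • Y p ∈ U := by
    have h3 : ∑ p ∈ square n, (δ⁻¹ * a p.1 p.2) • Y p =
        δ⁻¹ • truncation e₁ e₂ S₁ S₂ a n := by
      rw [truncation_eq_sum, Finset.smul_sum]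
      simp only [smul_smul]
      rfl
    have h4 := (hinv _).1 ⟨R, hR⟩
    rw [h3]
    simpa only [U, Set.mem_ofPred_eq, smul_smul, mul_inv_cancel₀ hδ, one_smul] using h4
  have hmem := ae_mem_of_tendsto_sum_smul hηm hηi (fun i => (hηl i).map_eq) Y monotone_square
    (Q := fun ω => perturbation e₁ e₂ S₁ S₂ fun j k => ξ (j, k) ω)
    (by
      filter_upwards [hη, ae_tendsto_truncation hlaw hind e₁ e₂ hS₁ hS₂] with ω h3 h4
      simp only [← h3]
      refine h4.congr fun n => ?_
      rw [truncation_eq_sum]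
      rfl)
    hU (fun s C b hb => by
      -- The operator is affine in the coefficients, with finite-rank directions $\delta Y_iG$.
      have e1 : ∀ x : s → ℂ, 1 + (δ • (C + ∑ i, x i • Y i) - Φ) * G =
          (1 + (δ • C - Φ) * G) + ∑ i, x i • (δ • Y i * G) := fun x => by
        simp only [smul_add, Finset.smul_sum, add_sub_right_comm, add_mul, Finset.sum_mul,
          ← add_assoc]
        congr 1
        refine Finset.sum_congr rfl fun i _ => ?_
        rw [smul_comm, smul_mul_assoc]
      have hb' : IsUnit ((1 + (δ • C - Φ) * G) + ∑ i, b i • (δ • Y i * G)) := by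
        rw [← e1]; exact hb
      have := measure_pi_setOf_not_isUnit (γ := stdComplexGaussian) _ _
        (fun i : s => ((hY i).smul δ).mul_right G) hb'
      simpa only [U, Set.mem_ofPred_eq, e1] using this)
    ha
  filter_upwards [hmem] with ω hω
  rw [notMem_spec_iff, shift_addBounded A Φ _ z z, hG.exists_iff, sub_self, zero_smul, sub_zero]
  exact hω

end AlmostSure

end RandomPerturbation

end

/-! ### Discreteness and the probability bound -/

theorem theorem2p3
    {H : Type*} [NormedAddCommGroup H] [InnerProductSpace ℂ H] [CompleteSpace H]
    [TopologicalSpace.SeparableSpace H]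
    -- the family of operators
    (A : ℝ → H →ₗ.[ℂ] H)
    (hA_closed : ∀ h > 0, (A h).IsClosed)
    (hA_dense : ∀ h > 0, Dense ((A h).domain : Set H))
    -- the sets `D_j` and the points `z_j`
    {ι : Type*} [Countable ι] (D : ℝ → ι → Set ℂ) (z : ℝ → ι → ℂ)
    (hD_open : ∀ h > 0, ∀ j, IsOpen (D h j))
    (hD_conn : ∀ h > 0, ∀ j, IsConnected (D h j))
    (hD_disj : ∀ h > 0, Pairwise fun i j => Disjoint (D h i) (D h j))
    (hD_fred : ∀ h > 0, (⋃ j, D h j) ⊆ fredholmDomainZero (A h))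
    (hz_mem : ∀ h > 0, ∀ j, z h j ∈ D h j)
    (hz_disc : ∀ h > 0, ∀ j, HasDiscreteSpectrum (rightSquare (A h) (z h j)))
    -- the operators `S₁(h, α)` and `S₂(h, α)`
    (S₁ S₂ : ℝ → ℝ → H →L[ℂ] H)
    (hS₁_hs : ∀ h > 0, ∀ α > 0, IsHilbertSchmidt (S₁ h α))
    (hS₂_hs : ∀ h > 0, ∀ α > 0, IsHilbertSchmidt (S₂ h α))
    (hS₁_tr : ∀ h > 0, ∀ α > 0, IsTraceClass (S₁ h α))
    (C_S : ℝ → ℝ → ℝ) (hC_S : ∀ h > 0, ∀ α > 0, 0 < C_S h α)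
    (hS₁_low : ∀ h > 0, ∀ α > 0, ∀ j, ∀ v ∈ lowSpace (leftSquare (A h) (z h j)) α,
      C_S h α * ‖v‖ ≤ ‖ContinuousLinearMap.adjoint (S₁ h α) v‖)
    (hS₂_low : ∀ h > 0, ∀ α > 0, ∀ j, ∀ w ∈ lowSpace (rightSquare (A h) (z h j)) α,
      C_S h α * ‖w‖ ≤ ‖S₂ h α w‖)
    -- the orthonormal bases and the Gaussian coefficients
    (e₁ e₂ : HilbertBasis ℕ ℂ H)
    {Ω : Type*} [MeasurableSpace Ω] (P : Measure Ω) [IsProbabilityMeasure P]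
    (ξ : ℕ → ℕ → Ω → ℂ)
    (hξ_law : ∀ j k, HasLaw (ξ j k) stdComplexGaussian P)
    (hξ_indep : iIndepFun (fun p : ℕ × ℕ => ξ p.1 p.2) P) :
    -- the series that defines `Q_ω` converges almost surely
    (∀ h > 0, ∀ α > 0, ∀ᵐ ω ∂P,
      Tendsto (truncation e₁ e₂ (S₁ h α) (S₂ h α) fun j k => ξ j k ω) atTop
        (𝓝 (perturbation e₁ e₂ (S₁ h α) (S₂ h α) fun j k => ξ j k ω))) ∧
    -- the spectrum of `A + δ Q_ω` in the union of the `D_j` is discrete with high probability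
    ∃ C₀ : ℝ, 0 < C₀ ∧ ∀ h > 0, ∀ α > 0, ∀ δ : ℝ, 0 < δ →
      ∃ E : Set Ω, MeasurableSet E ∧
        (∀ ω ∈ E, IsDiscrete
          (spec (addBounded (A h)
            ((δ : ℂ) • perturbation e₁ e₂ (S₁ h α) (S₂ h α) fun j k => ξ j k ω)) ∩
              ⋃ j, D h j)) ∧
        max (1 - C₀ * Real.exp
            ((C₀ * ‖S₁ h α‖ * traceNorm (S₁ h α) * hsNorm (S₂ h α) ^ 2 - α * δ⁻¹ ^ 2) /
              (2 * ‖S₁ h α‖ ^ (3 / 2 : ℝ) * ‖S₂ h α‖))) 0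
          ≤ P.real E := by
  have hlaw : ∀ p : ℕ × ℕ, HasLaw (ξ p.1 p.2) stdComplexGaussian P := fun p => hξ_law p.1 p.2
  have hconv : ∀ h > 0, ∀ α > 0, ∀ᵐ ω ∂P,
      Tendsto (truncation e₁ e₂ (S₁ h α) (S₂ h α) fun j k => ξ j k ω) atTop
        (𝓝 (perturbation e₁ e₂ (S₁ h α) (S₂ h α) fun j k => ξ j k ω)) := fun h hh α hα =>
    ae_tendsto_truncation hlaw hξ_indep e₁ e₂ (hS₁_hs h hh α hα) (hS₂_hs h hh α hα)
  -- The spectrum is discrete almost surely, so the probability bound holds with `C₀ = 1`.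
  refine ⟨hconv, 1, one_pos, fun h hh α hα δ hδ => ?_⟩
  have hres : ∀ᵐ ω ∂P, ∀ j, z h j ∉ spec (addBounded (A h)
      ((δ : ℂ) • perturbation e₁ e₂ (S₁ h α) (S₂ h α) fun j k => ξ j k ω)) := by
    refine ae_all_iff.2 fun j => ?_
    have hz : z h j ∈ fredholmDomainZero (A h) :=
      hD_fred h hh (Set.mem_iUnion.2 ⟨j, hz_mem h hh j⟩)
    refine ae_notMem_spec hz (hS₁_hs h hh α hα) (hS₂_hs h hh α hα) (fun c hc hc0 => ?_)
      (fun k hk hk0 => ?_) e₁ e₂ hlaw hξ_indep (Complex.ofReal_ne_zero.2 hδ.ne')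
    · have := hS₁_low h hh α hα j c (mem_lowSpace_leftSquare hα hz.1.dense hc)
      rw [hc0, norm_zero] at this
      exact norm_le_zero_iff.1 (nonpos_of_mul_nonpos_right this (hC_S h hh α hα))
    · have := hS₂_low h hh α hα j k (mem_lowSpace_rightSquare hα hk)
      rw [hk0, norm_zero] at this
      exact norm_le_zero_iff.1 (nonpos_of_mul_nonpos_right this (hC_S h hh α hα))
  have hdisc : ∀ᵐ ω ∂P, IsDiscrete (spec (addBounded (A h)
      ((δ : ℂ) • perturbation e₁ e₂ (S₁ h α) (S₂ h α) fun j k => ξ j k ω)) ∩ ⋃ j, D h j) := by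
    filter_upwards [hconv h hh α hα, hres] with ω hlim hω
    refine isDiscrete_of_eventually_notMem fun w hw => ?_
    obtain ⟨j, hj⟩ := Set.mem_iUnion.1 hw
    refine eventually_notMem_spec (hD_conn h hh j).isPreconnected
      ((Set.subset_iUnion _ j).trans (hD_fred h hh)) ?_ (hz_mem h hh j) (hω j) hj
    exact mem_closure_of_tendsto (hlim.const_smul (δ : ℂ))
      (Eventually.of_forall fun n => (isFiniteRank_truncation _ _ _ _ _ n).smul _)
  -- The discreteness event need not be measurable; the complement of a measurable null superset of
  -- its failure serves as `E`.
  obtain ⟨N, hN, hNm, hN0⟩ := exists_measurable_superset_of_null (ae_iff.1 hdisc)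
  refine ⟨Nᶜ, hNm.compl, fun ω hω => ?_, ?_⟩
  · by_contra hcon
    exact hω (hN hcon)
  -- Here $P(E)=1$, and the left side is at most $1$ whatever the quotient is, including the value
  -- $0$ for a vanishing denominator.
  · rw [probReal_compl_eq_one_sub hNm, measureReal_def, hN0, ENNReal.toReal_zero, sub_zero]
    exact max_le (sub_le_self _ (by positivity)) zero_le_one
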